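/- Let $n\ge 1$ be an integer and let $\beta\ge n+1$ be a real number. Let $\nu_\beta$ be the generalized Cauchy distribution on $\mathbb{R}^n$, that is, the probability measure with Lebesgue density $\frac1Z(1+|x|^2)^{-\beta}$, where $|\cdot|$ is the Euclidean norm and $Z$ is the normalizing constant, and let $\tilde\nu_\beta$ be the image of $\nu_\beta$ under the map $x\mapsto\sqrt{2\beta-n}\,x$ (so $\tilde\nu_\beta$ is the probability measure with density proportional to $\bigl(1+\frac{|x|^2}{2\beta-n}\bigr)^{-\beta}$). Put $$p=2\left[\beta-\tfrac34 n\right],\qquad t_0=4\sqrt{e\left[\beta-\tfrac34 n\right]},\qquad t_1=7e\left[\beta-\tfrac34 n\right],$$ where $[\,\cdot\,]$ denotes the integer part. Then, for every function $f:\mathbb{R}^n\to\mathbb{R}$ that is $1$-Lipschitz for the Euclidean norm and satisfies $\int f\,d\tilde\nu_\beta=0$, $$\tilde\nu_\beta(|f|\ge t)\le\begin{cases}2e^{-t^2/(32e)}, & \text{if } 0\le t<t_0,\\[2pt] 2e^{-t/(7e)}, & \text{if } t_0\le t\le t_1,\\[2pt] 2\left(\frac{7p}{t}\right)^p, & \text{if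 } t\ge t_1.\end{cases}$$ -/

import Mathlib

open MeasureTheory

noncomputable section

/-- The unnormalized generalized Cauchy measure on `ℝⁿ`, with Lebesgue density
`x ↦ (1 + |x|²)^(-β)`, where `|x|` is the Euclidean norm. -/
def cauchyWeight (n : ℕ) (β : ℝ) : Measure (EuclideanSpace ℝ (Fin n)) :=
  volume.withDensity fun x => ENNReal.ofReal ((1 + ‖x‖ ^ 2) ^ (-β))

/-- The generalized Cauchy distribution `ν_β` on `ℝⁿ`, with Lebesgue density
`Z⁻¹ (1 + |x|²)^(-β)`, where `Z` is the total mass of the unnormalized measure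
(positive and finite as soon as `n / 2 < β`). -/
def cauchyDistribution (n : ℕ) (β : ℝ) : Measure (EuclideanSpace ℝ (Fin n)) :=
  (cauchyWeight n β Set.univ)⁻¹ • cauchyWeight n β

/-- The rescaled Cauchy distribution: the image of `ν_β` under `x ↦ √(2β - n) x`. -/
def rescaledCauchy (n : ℕ) (β : ℝ) : Measure (EuclideanSpace ℝ (Fin n)) :=
  (cauchyDistribution n β).map fun x => √(2 * β - n) • x

/-- The integer part `[β - 3n/4]` (this number is at least `1` when `β ≥ n + 1`). -/
def cauchyIndex (n : ℕ) (β : ℝ) : ℕ := ⌊β - 3 / 4 * (n : ℝ)⌋₊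

/-- The exponent `p = 2 [β - 3n/4]` of the polynomial tail. -/
def tailExponent (n : ℕ) (β : ℝ) : ℕ := 2 * cauchyIndex n β

/-- The threshold `t₀ = 4 √(e [β - 3n/4])`. -/
def tailStart (n : ℕ) (β : ℝ) : ℝ := 4 * √(Real.exp 1 * cauchyIndex n β)

/-- The threshold `t₁ = 7 e [β - 3n/4]`. -/
def tailEnd (n : ℕ) (β : ℝ) : ℝ := 7 * Real.exp 1 * cauchyIndex n β

end

/-!
Write `a = β - n / 2` and `k = cauchyIndex n β`, so that `k ≤ a - n / 4`, `n ≤ 2 (a - 1)` and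
`a < 2 k + 1`. The rescaled Cauchy distribution is a Gaussian mixture: it is the law of `g / √s`,
with `g` standard Gaussian in dimension `n` and `s` an independent Gamma variable of shape `a` and
mean `1` (`rescaledCauchy_eq_map_gamma_prod_stdGaussian`).

Given `s`, the function `f` is `s ^ (-1/2)`-Lipschitz in `g`, so it concentrates around its
conditional mean by the Maurey–Pisier argument: the rotation from one Gaussian vector to an
independent copy preserves their joint law, and the derivative of `f` along the velocity is a scalar
Gaussian (`stdGaussian_le_abs_sub_integral_le`). The conditional mean varies with `s` by at most
`√n` times the variation of `s ^ (-1/2)`, and it averages to zero; since `n ≤ 2 (a - 1)`, it is at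
most `√n |s ^ (-1/2) - 1| + √2` (`abs_integral_comp_inv_sqrt_smul_le`). Chernoff bounds for `s`, and
its Laplace transform `(1 + c / a) ^ (-a)`, then bound the tail at `t = 4 √(e q)` by
`4 exp (-q) ≤ 2 exp (-q / 2)` for `2 log 2 ≤ q ≤ a - n / 4` (`rescaledCauchy_gaussian_range`).
This is the first regime.

For large `t` the moment of order `2 k` is enough. It is bounded through the norm alone, because
`E (1 + |x|²) ^ k` is a ratio of normalizing constants and at most `3 ^ k`; this gives the tail bound
`(24 a / t²) ^ k` (`rescaledCauchy_polynomial_tail`), hence the third regime since `a ≤ 3 k`. The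
exponential regime is covered by these two estimates
(`rescaledCauchy_exponential_range`). In dimension zero `f` vanishes identically.
-/

open MeasureTheory ProbabilityTheory
open scoped ContDiff ENNReal NNReal

/-! ### Gaussian concentration of Lipschitz functions -/

/-- Convolution with a bump function supported in the ball of radius `ε` moves a `1`-Lipschitz
function by at most `ε` and keeps it `1`-Lipschitz. -/
lemma LipschitzWith.exists_contDiff_lipschitzWith_dist_le {E : Type*} [NormedAddCommGroup E]
    [InnerProductSpace ℝ E] [FiniteDimensional ℝ E] {f : E → ℝ} (hf : LipschitzWith 1 f)
    {ε : ℝ} (hε : 0 < ε) :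
    ∃ g : E → ℝ, ContDiff ℝ ∞ g ∧ LipschitzWith 1 g ∧ ∀ x, dist (g x) (f x) ≤ ε := by
  borelize E
  let φ : ContDiffBump (0 : E) := ⟨ε / 2, ε, half_pos hε, half_lt_self hε⟩
  let μ : Measure E := volume
  have hcont : Continuous f := hf.continuous
  have hconv (x : E) :
      convolution (φ.normed μ) f (ContinuousLinearMap.lsmul ℝ ℝ) μ x
        = ∫ t, φ.normed μ t * f (x - t) ∂μ := by
    simp [convolution_def]
  have hint (x : E) : Integrable (fun t => φ.normed μ t * f (x - t)) μ := by
    refine Continuous.integrable_of_hasCompactSupport ?_ ?_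
    · exact φ.continuous_normed.mul (hcont.comp (by fun_prop))
    · exact φ.hasCompactSupport_normed.mul_right
  refine ⟨convolution (φ.normed μ) f (ContinuousLinearMap.lsmul ℝ ℝ) μ, ?_, ?_, fun x => ?_⟩
  · exact φ.hasCompactSupport_normed.contDiff_convolution_left _ φ.contDiff_normed
      hcont.locallyIntegrable
  · refine LipschitzWith.of_dist_le_mul fun x y => ?_
    rw [hconv, hconv, Real.dist_eq, ← integral_sub (hint x) (hint y), ← Real.norm_eq_abs]
    calc ‖∫ t, (φ.normed μ t * f (x - t) - φ.normed μ t * f (y - t)) ∂μ‖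
        ≤ ∫ t, φ.normed μ t * dist x y ∂μ := by
          refine norm_integral_le_of_norm_le (φ.integrable_normed.mul_const _) ?_
          refine Filter.Eventually.of_forall fun t => ?_
          rw [← mul_sub, norm_mul, Real.norm_of_nonneg (φ.nonneg_normed t)]
          refine mul_le_mul_of_nonneg_left ?_ (φ.nonneg_normed t)
          simpa [Real.dist_eq] using hf.dist_le_mul (x - t) (y - t)
      _ = ((1 : ℝ≥0) : ℝ) * dist x y := by
          rw [integral_mul_const, φ.integral_normed]; simp
  · refine φ.dist_normed_convolution_le hcont.aestronglyMeasurable fun y hy => ?_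
    have h := hf.dist_le_mul y x
    have h' : dist y x < ε := hy
    simp only [NNReal.coe_one, one_mul] at h
    linarith

section Gaussian

variable {E : Type*} [NormedAddCommGroup E] [InnerProductSpace ℝ E] [FiniteDimensional ℝ E]
  [MeasurableSpace E] [BorelSpace E]

lemma lintegral_exp_mul_dual_stdGaussian (L : StrongDual ℝ E) (c : ℝ) :
    ∫⁻ x, ENNReal.ofReal (Real.exp (c * L x)) ∂(stdGaussian E)
      = ENNReal.ofReal (Real.exp (c ^ 2 * ‖L‖ ^ 2 / 2)) := by
  have hmap : (stdGaussian E).map L = gaussianReal 0 (‖L‖ ^ 2).toNNReal := by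
    rw [IsGaussian.map_eq_gaussianReal L, integral_strongDual_stdGaussian,
      variance_dual_stdGaussian]
  have h1 : ∫⁻ x, ENNReal.ofReal (Real.exp (c * L x)) ∂(stdGaussian E)
      = ∫⁻ y, ENNReal.ofReal (Real.exp (c * y)) ∂((stdGaussian E).map L) := by
    rw [lintegral_map (by fun_prop) (by fun_prop)]
  rw [h1, hmap, ← ofReal_integral_eq_lintegral_ofReal
    (integrable_exp_mul_gaussianReal c) (Filter.Eventually.of_forall fun _ => (Real.exp_pos _).le)]
  have h2 := congrFun (mgf_id_gaussianReal (μ := 0) (v := (‖L‖ ^ 2).toNNReal)) c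
  simp only [mgf, id] at h2
  rw [h2]
  congr 2
  rw [Real.coe_toNNReal _ (by positivity)]
  ring

lemma map_rotation_stdGaussian (θ : ℝ) :
    ((stdGaussian E).prod (stdGaussian E)).map (ContinuousLinearMap.rotation θ)
      = (stdGaussian E).prod (stdGaussian E) :=
  IsGaussian.map_rotation_eq_self_of_forall_strongDual_eq_zero
    (fun L => integral_strongDual_stdGaussian L) θ

end Gaussian

lemma ofReal_integral_le_lintegral_ofReal {α : Type*} [MeasurableSpace α] {μ : Measure α}
    {f : α → ℝ} (hf : Integrable f μ) :
    ENNReal.ofReal (∫ x, f x ∂μ) ≤ ∫⁻ x, ENNReal.ofReal (f x) ∂μ := by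
  rw [integral_eq_lintegral_pos_part_sub_lintegral_neg_part hf]
  exact (ENNReal.ofReal_le_ofReal (sub_le_self _ ENNReal.toReal_nonneg)).trans
    ENNReal.ofReal_toReal_le

/-- Along the arc `θ ↦ cos θ • x + sin θ • y` from `x` to `y`, whose velocity is the second
component of the rotated pair, write `h y - h x` as the integral of the derivative of `h` and apply
Jensen's inequality to the average over `θ ∈ (0, π / 2]`. -/
lemma ofReal_exp_sub_le_lintegral_rotation {E : Type*} [NormedAddCommGroup E]
    [NormedSpace ℝ E] {h : E → ℝ} (hh : ContDiff ℝ ∞ h) (c : ℝ)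
    (p : E × E) :
    ENNReal.ofReal (Real.exp (c * (h p.2 - h p.1))) ≤
      ENNReal.ofReal (Real.pi / 2)⁻¹ * ∫⁻ θ in Set.Ioc 0 (Real.pi / 2),
        ENNReal.ofReal (Real.exp (c * (Real.pi / 2) *
          fderiv ℝ h (ContinuousLinearMap.rotation θ p).1
            (ContinuousLinearMap.rotation θ p).2)) := by
  have hpi : 0 < Real.pi / 2 := by positivity
  set D : ℝ → ℝ := fun θ => fderiv ℝ h (ContinuousLinearMap.rotation θ p).1
            (ContinuousLinearMap.rotation θ p).2 with hD
  have hfd : Continuous (fderiv ℝ h) := hh.continuous_fderiv (by simp)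
  have hDc : Continuous D := by
    simp only [hD, ContinuousLinearMap.rotation_apply]
    exact (hfd.comp (by fun_prop)).clm_apply (by fun_prop)
  have hderiv (θ : ℝ) : HasDerivAt (fun θ => h (ContinuousLinearMap.rotation θ p).1) (D θ) θ := by
    have h1 : HasDerivAt (fun θ : ℝ => (ContinuousLinearMap.rotation θ p).1)
        (ContinuousLinearMap.rotation θ p).2 θ := by
      simp only [ContinuousLinearMap.rotation_apply]
      exact ((Real.hasDerivAt_cos θ).smul_const p.1).add ((Real.hasDerivAt_sin θ).smul_const p.2)
    exact ((hh.differentiable (by simp)) _).hasFDerivAt.comp_hasDerivAt θ h1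
  have hftc : h p.2 - h p.1 = ∫ θ in Set.Ioc 0 (Real.pi / 2), D θ := by
    rw [← intervalIntegral.integral_of_le hpi.le,
      intervalIntegral.integral_eq_sub_of_hasDerivAt (fun θ _ => hderiv θ)
        (hDc.intervalIntegrable _ _)]
    simp [ContinuousLinearMap.rotation_apply]
  have : NeZero ((volume.restrict (Set.Ioc 0 (Real.pi / 2)) : Measure ℝ)) := ⟨by
    rw [Ne, Measure.restrict_eq_zero]; simp [hpi]⟩
  have hint (g : ℝ → ℝ) (hg : Continuous g) : IntegrableOn g (Set.Ioc 0 (Real.pi / 2)) :=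
    (hg.integrableOn_Icc).mono_set Set.Ioc_subset_Icc_self
  have hJ := convexOn_exp.map_average_le (μ := volume.restrict (Set.Ioc 0 (Real.pi / 2)))
    (f := fun θ => c * (Real.pi / 2) * D θ) Real.continuous_exp.continuousOn isClosed_univ
    (by simp) (hint _ (by fun_prop)) (hint _ (Real.continuous_exp.comp (by fun_prop)))
  rw [average_eq, average_eq, integral_const_mul, ← hftc] at hJ
  have hvol : (volume.restrict (Set.Ioc 0 (Real.pi / 2)) : Measure ℝ).real Set.univ
      = Real.pi / 2 := by simp [hpi.le]
  rw [hvol, smul_eq_mul, smul_eq_mul] at hJ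
  rw [show (Real.pi / 2)⁻¹ * (c * (Real.pi / 2) * (h p.2 - h p.1)) = c * (h p.2 - h p.1) by
    field_simp] at hJ
  refine (ENNReal.ofReal_le_ofReal hJ).trans (le_of_eq ?_)
  rw [ENNReal.ofReal_mul (by positivity), ofReal_integral_eq_lintegral_ofReal
    (hint (fun θ => Real.exp (c * (Real.pi / 2) * D θ)) (by fun_prop))
    (Filter.Eventually.of_forall fun _ => (Real.exp_pos _).le)]

section Gaussian

variable {E : Type*} [NormedAddCommGroup E] [InnerProductSpace ℝ E] [FiniteDimensional ℝ E]
  [MeasurableSpace E] [BorelSpace E]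

/-- The pair of position and velocity on the arc is again a pair of independent standard Gaussians,
so, given the position, the derivative of `h` along the velocity is a centered Gaussian of variance
`‖fderiv ℝ h x‖ ^ 2 ≤ 1`. -/
lemma lintegral_exp_sub_stdGaussian_le_of_contDiff {h : E → ℝ} (hh : ContDiff ℝ ∞ h)
    (hlip : LipschitzWith 1 h) (c : ℝ) :
    ∫⁻ p, ENNReal.ofReal (Real.exp (c * (h p.2 - h p.1))) ∂((stdGaussian E).prod (stdGaussian E))
      ≤ ENNReal.ofReal (Real.exp (Real.pi ^ 2 * c ^ 2 / 8)) := by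
  set γ := stdGaussian E
  have hpi : 0 < Real.pi / 2 := by positivity
  have hfd : Continuous (fderiv ℝ h) := hh.continuous_fderiv (by simp)
  let G : E × E → ℝ≥0∞ := fun q =>
    ENNReal.ofReal (Real.exp (c * (Real.pi / 2) * fderiv ℝ h q.1 q.2))
  have hG : Continuous G := ENNReal.continuous_ofReal.comp (Real.continuous_exp.comp
    (continuous_const.mul ((hfd.comp continuous_fst).clm_apply continuous_snd)))
  have hbound : ∫⁻ q, G q ∂(γ.prod γ) ≤ ENNReal.ofReal (Real.exp (Real.pi ^ 2 * c ^ 2 / 8)) := by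
    rw [lintegral_prod _ hG.measurable.aemeasurable]
    calc ∫⁻ x, ∫⁻ y, G (x, y) ∂γ ∂γ
        ≤ ∫⁻ _, ENNReal.ofReal (Real.exp (Real.pi ^ 2 * c ^ 2 / 8)) ∂γ := by
          refine lintegral_mono fun x => ?_
          simp only [G]
          rw [lintegral_exp_mul_dual_stdGaussian]
          refine ENNReal.ofReal_le_ofReal (Real.exp_le_exp.2 ?_)
          have h1 : ‖fderiv ℝ h x‖ ≤ 1 := by
            simpa using norm_fderiv_le_of_lipschitz ℝ hlip (x₀ := x)
          have h2 : ‖fderiv ℝ h x‖ ^ 2 ≤ 1 := pow_le_one₀ (norm_nonneg _) h1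
          nlinarith [mul_nonneg (sq_nonneg (c * Real.pi)) (sub_nonneg.2 h2)]
      _ = _ := by simp
  calc ∫⁻ p, ENNReal.ofReal (Real.exp (c * (h p.2 - h p.1))) ∂(γ.prod γ)
      ≤ ∫⁻ p, ENNReal.ofReal (Real.pi / 2)⁻¹ * (∫⁻ θ in Set.Ioc 0 (Real.pi / 2),
        G (ContinuousLinearMap.rotation θ p)) ∂(γ.prod γ) :=
        lintegral_mono fun p => ofReal_exp_sub_le_lintegral_rotation hh c p
    _ = ENNReal.ofReal (Real.pi / 2)⁻¹ * ∫⁻ θ in Set.Ioc 0 (Real.pi / 2),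
        ∫⁻ p, G (ContinuousLinearMap.rotation θ p) ∂(γ.prod γ) := by
        have hm : Measurable fun q : (E × E) × ℝ => G (ContinuousLinearMap.rotation q.2 q.1) := by
          refine (hG.comp ?_).measurable
          simp only [ContinuousLinearMap.rotation_apply]
          fun_prop
        rw [lintegral_const_mul _ hm.lintegral_prod_right', lintegral_lintegral_swap
          hm.aemeasurable]
    _ = ENNReal.ofReal (Real.pi / 2)⁻¹ * ∫⁻ _ in Set.Ioc 0 (Real.pi / 2),
        ∫⁻ q, G q ∂(γ.prod γ) := by
        congr 1
        refine lintegral_congr fun θ => ?_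
        conv_rhs => rw [← map_rotation_stdGaussian θ]
        rw [lintegral_map hG.measurable (ContinuousLinearMap.continuous _).measurable]
    _ = ∫⁻ q, G q ∂(γ.prod γ) := by
        rw [lintegral_const, Measure.restrict_apply_univ, Real.volume_Ioc, sub_zero, mul_comm,
          mul_assoc, ← ENNReal.ofReal_mul hpi.le, mul_inv_cancel₀ hpi.ne', ENNReal.ofReal_one,
          mul_one]
    _ ≤ _ := hbound

/-- The Maurey–Pisier inequality: the Laplace transform of `f y - f x`, for independent standard
Gaussians `x` and `y` and a `1`-Lipschitz `f`, is at most `exp (π² c² / 8)`. -/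
lemma lintegral_exp_sub_stdGaussian_le {f : E → ℝ} (hf : LipschitzWith 1 f) (c : ℝ) :
    ∫⁻ p, ENNReal.ofReal (Real.exp (c * (f p.2 - f p.1))) ∂((stdGaussian E).prod (stdGaussian E))
      ≤ ENNReal.ofReal (Real.exp (Real.pi ^ 2 * c ^ 2 / 8)) := by
  have key (ε : ℝ) (hε : 0 < ε) :
      ∫⁻ p, ENNReal.ofReal (Real.exp (c * (f p.2 - f p.1)))
        ∂((stdGaussian E).prod (stdGaussian E))
      ≤ ENNReal.ofReal (Real.exp (2 * |c| * ε + Real.pi ^ 2 * c ^ 2 / 8)) := by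
    obtain ⟨g, hg, hgl, hgf⟩ := hf.exists_contDiff_lipschitzWith_dist_le hε
    rw [Real.exp_add, ENNReal.ofReal_mul (Real.exp_pos _).le]
    refine le_trans ?_ (mul_le_mul_right (lintegral_exp_sub_stdGaussian_le_of_contDiff hg hgl c) _)
    rw [← lintegral_const_mul' _ _ ENNReal.ofReal_ne_top]
    refine lintegral_mono fun p => ?_
    rw [← ENNReal.ofReal_mul (Real.exp_pos _).le, ← Real.exp_add]
    refine ENNReal.ofReal_le_ofReal (Real.exp_le_exp.2 ?_)
    have h1 := hgf p.1
    have h2 := hgf p.2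
    rw [Real.dist_eq] at h1 h2
    have h3 : |(f p.2 - g p.2) - (f p.1 - g p.1)| ≤ 2 * ε := by
      rw [abs_sub_comm] at h1 h2
      linarith [abs_sub (f p.2 - g p.2) (f p.1 - g p.1)]
    have h4 : c * ((f p.2 - g p.2) - (f p.1 - g p.1)) ≤ |c| * (2 * ε) :=
      (le_abs_self _).trans (by rw [abs_mul]; gcongr)
    linarith
  have hlim : Filter.Tendsto
      (fun ε : ℝ => ENNReal.ofReal (Real.exp (2 * |c| * ε + Real.pi ^ 2 * c ^ 2 / 8)))
      (nhdsWithin 0 (Set.Ioi 0))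
      (nhds (ENNReal.ofReal (Real.exp (2 * |c| * 0 + Real.pi ^ 2 * c ^ 2 / 8)))) := by
    refine Filter.Tendsto.mono_left ?_ nhdsWithin_le_nhds
    exact (ENNReal.continuous_ofReal.comp (by fun_prop)).tendsto 0
  rw [mul_zero, zero_add] at hlim
  exact ge_of_tendsto hlim (Filter.eventually_of_mem self_mem_nhdsWithin key)

lemma LipschitzWith.integrable_stdGaussian {f : E → ℝ} {K : ℝ≥0} (hf : LipschitzWith K f) :
    Integrable f (stdGaussian E) := by
  have h1 : Integrable (fun x : E => |f 0| + K * ‖x‖) (stdGaussian E) :=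
    (integrable_const _).add ((IsGaussian.integrable_id (μ := stdGaussian E)).norm.const_mul _)
  refine h1.mono' hf.continuous.aestronglyMeasurable (Filter.Eventually.of_forall fun x => ?_)
  have := hf.dist_le_mul x 0
  rw [dist_zero_right, Real.dist_eq] at this
  rw [Real.norm_eq_abs]
  linarith [abs_sub_abs_le_abs_sub (f x) (f 0)]

lemma lintegral_exp_sub_integral_stdGaussian_le {f : E → ℝ} (hf : LipschitzWith 1 f) (c : ℝ) :
    ∫⁻ x, ENNReal.ofReal (Real.exp (c * (f x - ∫ y, f y ∂(stdGaussian E)))) ∂(stdGaussian E)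
      ≤ ENNReal.ofReal (Real.exp (Real.pi ^ 2 * c ^ 2 / 8)) := by
  set γ := stdGaussian E
  set m := ∫ y, f y ∂γ with hm
  have hfc := hf.continuous
  have hfi : Integrable f γ := hf.integrable_stdGaussian
  refine le_trans ?_ (lintegral_exp_sub_stdGaussian_le hf c)
  have hmeas : Measurable fun p : E × E => ENNReal.ofReal (Real.exp (c * (f p.2 - f p.1))) := by
    have : Continuous fun p : E × E => ENNReal.ofReal (Real.exp (c * (f p.2 - f p.1))) :=
      ENNReal.continuous_ofReal.comp (by fun_prop)
    exact this.measurable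
  rw [lintegral_prod_symm _ hmeas.aemeasurable]
  refine lintegral_mono fun y => ?_
  -- `exp z ≥ 1 + z` integrates to `1` because `c * (m - f)` has mean zero
  have h1 : 1 ≤ ∫⁻ x, ENNReal.ofReal (Real.exp (c * (m - f x))) ∂γ := by
    have hi : Integrable (fun x => 1 + c * (m - f x)) γ :=
      (integrable_const _).add (((integrable_const _).sub hfi).const_mul _)
    have hi' : Integrable (fun x => c * (m - f x)) γ :=
      ((integrable_const _).sub hfi).const_mul _
    have h2 : ∫ x, (1 + c * (m - f x)) ∂γ = 1 := by
      rw [integral_add (integrable_const _) hi',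
        integral_const_mul, integral_sub (integrable_const _) hfi]
      simp [hm]
    calc (1 : ℝ≥0∞) = ENNReal.ofReal (∫ x, (1 + c * (m - f x)) ∂γ) := by simp [h2]
      _ ≤ ∫⁻ x, ENNReal.ofReal (1 + c * (m - f x)) ∂γ := ofReal_integral_le_lintegral_ofReal hi
      _ ≤ _ := by
        refine lintegral_mono fun x => ENNReal.ofReal_le_ofReal ?_
        linarith [Real.add_one_le_exp (c * (m - f x))]
  calc ENNReal.ofReal (Real.exp (c * (f y - m)))
      = ENNReal.ofReal (Real.exp (c * (f y - m))) * 1 := (mul_one _).symm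
    _ ≤ ENNReal.ofReal (Real.exp (c * (f y - m))) *
        ∫⁻ x, ENNReal.ofReal (Real.exp (c * (m - f x))) ∂γ := by gcongr
    _ = ∫⁻ x, ENNReal.ofReal (Real.exp (c * (f y - f x))) ∂γ := by
      rw [← lintegral_const_mul' _ _ ENNReal.ofReal_ne_top]
      refine lintegral_congr fun x => ?_
      rw [← ENNReal.ofReal_mul (Real.exp_pos _).le, ← Real.exp_add]
      congr 2; ring

/-- Gaussian concentration, upper tail. -/
lemma stdGaussian_le_sub_integral_le {f : E → ℝ} (hf : LipschitzWith 1 f) {u : ℝ} (hu : 0 ≤ u) :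
    stdGaussian E {x | u ≤ f x - ∫ y, f y ∂(stdGaussian E)}
      ≤ ENNReal.ofReal (Real.exp (-(2 * u ^ 2 / Real.pi ^ 2))) := by
  set γ := stdGaussian E
  set m := ∫ y, f y ∂γ
  have hfc := hf.continuous
  have hpi := Real.pi_pos
  -- the minimizer of `π² c² / 8 - c u`
  set c : ℝ := 4 * u / Real.pi ^ 2 with hc
  have hc0 : 0 ≤ c := by positivity
  calc γ {x | u ≤ f x - m}
      ≤ ∫⁻ x, ENNReal.ofReal (Real.exp (-(c * u))) *
          ENNReal.ofReal (Real.exp (c * (f x - m))) ∂γ := by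
        have hms : MeasurableSet {x | u ≤ f x - m} :=
          measurableSet_le measurable_const (hfc.measurable.sub_const _)
        rw [← lintegral_indicator_one hms]
        refine lintegral_mono (Set.indicator_le fun x hx => ?_)
        rw [← ENNReal.ofReal_mul (Real.exp_pos _).le, ← Real.exp_add, Pi.one_apply,
          ← ENNReal.ofReal_one]
        refine ENNReal.ofReal_le_ofReal (Real.one_le_exp ?_)
        have : u ≤ f x - m := hx
        nlinarith
    _ ≤ ENNReal.ofReal (Real.exp (-(c * u))) *
        ENNReal.ofReal (Real.exp (Real.pi ^ 2 * c ^ 2 / 8)) := by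
        rw [lintegral_const_mul' _ _ ENNReal.ofReal_ne_top]
        gcongr
        exact lintegral_exp_sub_integral_stdGaussian_le hf c
    _ = _ := by
        rw [← ENNReal.ofReal_mul (Real.exp_pos _).le, ← Real.exp_add]
        congr 2
        rw [hc]; field_simp; ring

/-- Gaussian concentration of a `K`-Lipschitz function around its mean. -/
lemma stdGaussian_le_abs_sub_integral_le {f : E → ℝ} {K : ℝ≥0} (hK : 0 < K)
    (hf : LipschitzWith K f) {u : ℝ} (hu : 0 ≤ u) :
    stdGaussian E {x | u ≤ |f x - ∫ y, f y ∂(stdGaussian E)|}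
      ≤ ENNReal.ofReal (2 * Real.exp (-(2 * u ^ 2 / (Real.pi ^ 2 * K ^ 2)))) := by
  set γ := stdGaussian E
  have hKr : (0 : ℝ) < K := hK
  have hg : LipschitzWith 1 fun x => (K : ℝ)⁻¹ * f x := by
    refine LipschitzWith.of_dist_le_mul fun x y => ?_
    have := hf.dist_le_mul x y
    rw [Real.dist_eq] at this ⊢
    rw [← mul_sub, abs_mul, abs_of_pos (inv_pos.2 hKr), NNReal.coe_one, one_mul,
      inv_mul_le_iff₀ hKr]
    exact this
  have hg' : LipschitzWith 1 fun x => -((K : ℝ)⁻¹ * f x) := hg.neg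
  have hu' : 0 ≤ u / K := by positivity
  have hsub : {x | u ≤ |f x - ∫ y, f y ∂γ|} ⊆
      {x | u / K ≤ (K : ℝ)⁻¹ * f x - ∫ y, (K : ℝ)⁻¹ * f y ∂γ} ∪
      {x | u / K ≤ -((K : ℝ)⁻¹ * f x) - ∫ y, -((K : ℝ)⁻¹ * f y) ∂γ} := by
    intro x hx
    simp only [Set.mem_union, Set.mem_ofPred_eq, integral_neg, integral_const_mul] at hx ⊢
    rw [div_le_iff₀ hKr, div_le_iff₀ hKr]
    have e1 : ((K : ℝ)⁻¹ * f x - (K : ℝ)⁻¹ * ∫ y, f y ∂γ) * K = f x - ∫ y, f y ∂γ := by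
      field_simp
    have e2 : (-((K : ℝ)⁻¹ * f x) - -((K : ℝ)⁻¹ * ∫ y, f y ∂γ)) * K
        = -(f x - ∫ y, f y ∂γ) := by
      field_simp; ring
    rw [e1, e2]
    exact le_abs.1 hx
  refine (measure_mono hsub).trans ((measure_union_le _ _).trans ?_)
  refine (add_le_add (stdGaussian_le_sub_integral_le hg hu')
    (stdGaussian_le_sub_integral_le hg' hu')).trans (le_of_eq ?_)
  rw [← ENNReal.ofReal_add (Real.exp_pos _).le (Real.exp_pos _).le, ← two_mul]
  congr 4
  field_simp

end Gaussian

/-! ### Gamma integrals and the Gaussian mixture -/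

lemma lintegral_rpow_mul_exp_neg_mul_Ioi {a r : ℝ} (ha : 0 < a) (hr : 0 < r) :
    ∫⁻ s in Set.Ioi (0 : ℝ), ENNReal.ofReal (s ^ (a - 1) * Real.exp (-(r * s)))
      = ENNReal.ofReal ((1 / r) ^ a * Real.Gamma a) := by
  have h := Real.integral_rpow_mul_exp_neg_mul_Ioi ha hr
  have hpos : 0 < (1 / r) ^ a * Real.Gamma a := by
    have := Real.Gamma_pos_of_pos ha
    positivity
  rw [← h] at hpos ⊢
  have hi := not_imp_comm.1 integral_undef hpos.ne'
  refine (ofReal_integral_eq_lintegral_ofReal hi ?_).symm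
  filter_upwards [ae_restrict_mem measurableSet_Ioi] with s hs
  have : (0 : ℝ) < s := hs
  simp only [Pi.zero_apply]
  positivity

lemma lintegral_gammaMeasure {a r : ℝ} {φ : ℝ → ℝ≥0∞} (hφ : Measurable φ) :
    ∫⁻ s, φ s ∂(gammaMeasure a r) = ∫⁻ s in Set.Ioi (0 : ℝ),
      ENNReal.ofReal (r ^ a / Real.Gamma a * s ^ (a - 1) * Real.exp (-(r * s))) * φ s := by
  have hmeas : Measurable (gammaPDF a r) := (measurable_gammaPDFReal a r).ennreal_ofReal
  rw [gammaMeasure, lintegral_withDensity_eq_lintegral_mul _ hmeas hφ,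
    ← lintegral_add_compl _ (measurableSet_Ici (a := (0 : ℝ)))]
  have h0 : ∫⁻ s in (Set.Ici (0 : ℝ))ᶜ, (gammaPDF a r * φ) s = 0 := by
    rw [setLIntegral_congr_fun (g := fun _ => 0) measurableSet_Ici.compl, lintegral_zero]
    intro s hs
    simp [gammaPDF_of_neg (not_le.1 hs)]
  rw [h0, add_zero, setLIntegral_congr Ioi_ae_eq_Ici.symm]
  refine setLIntegral_congr_fun measurableSet_Ioi fun s hs => ?_
  rw [Pi.mul_apply, gammaPDF_of_nonneg (Set.mem_Ioi.1 hs).le]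

lemma lintegral_rpow_mul_exp_gammaMeasure {a r p c : ℝ} (ha : 0 < a) (hr : 0 < r)
    (hp : 0 < a + p) (hc : c < r) :
    ∫⁻ s, ENNReal.ofReal (s ^ p * Real.exp (c * s)) ∂(gammaMeasure a r)
      = ENNReal.ofReal (r ^ a / Real.Gamma a * ((1 / (r - c)) ^ (a + p) * Real.Gamma (a + p))) := by
  have hG := Real.Gamma_pos_of_pos ha
  rw [lintegral_gammaMeasure (by fun_prop), ENNReal.ofReal_mul (by positivity),
    ← lintegral_rpow_mul_exp_neg_mul_Ioi hp (sub_pos.2 hc),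
    ← lintegral_const_mul' _ _ ENNReal.ofReal_ne_top]
  refine setLIntegral_congr_fun measurableSet_Ioi fun s hs => ?_
  have hs' : (0 : ℝ) < s := hs
  rw [← ENNReal.ofReal_mul (by positivity), ← ENNReal.ofReal_mul (by positivity)]
  congr 1
  rw [show a + p - 1 = (a - 1) + p by ring, Real.rpow_add hs',
    show -((r - c) * s) = -(r * s) + c * s by ring, Real.exp_add]
  ring

lemma lintegral_exp_gammaMeasure {a r c : ℝ} (ha : 0 < a) (hr : 0 < r) (hc : c < r) :
    ∫⁻ s, ENNReal.ofReal (Real.exp (c * s)) ∂(gammaMeasure a r)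
      = ENNReal.ofReal ((1 - c / r) ^ (-a)) := by
  have h := lintegral_rpow_mul_exp_gammaMeasure (p := 0) ha hr (by simpa using ha) hc
  simp only [Real.rpow_zero, one_mul, add_zero] at h
  rw [h]
  congr 1
  have hG := (Real.Gamma_pos_of_pos ha).ne'
  have hrc : 0 < r - c := sub_pos.2 hc
  rw [show 1 - c / r = (r - c) / r by field_simp, Real.rpow_neg (by positivity),
    Real.div_rpow hrc.le hr.le, Real.div_rpow zero_le_one hrc.le, Real.one_rpow]
  have := (Real.rpow_pos_of_pos hrc a).ne'
  have := (Real.rpow_pos_of_pos hr a).ne'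
  field_simp

lemma gammaMeasure_ae_pos (a r : ℝ) : ∀ᵐ s ∂(gammaMeasure a r), 0 < s := by
  rw [ae_iff]
  have hm : MeasurableSet {s : ℝ | ¬ 0 < s} := measurableSet_Ioi.compl
  rw [← lintegral_indicator_one hm, lintegral_gammaMeasure (measurable_one.indicator hm)]
  rw [setLIntegral_congr_fun (g := fun _ => 0) measurableSet_Ioi, lintegral_zero]
  intro s hs
  have : (0 : ℝ) < s := hs
  simp [this]

section Density

variable {E : Type*} [NormedAddCommGroup E] [InnerProductSpace ℝ E] [FiniteDimensional ℝ E]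
  [MeasurableSpace E] [BorelSpace E]

/-- The Lebesgue density of the centered Gaussian measure with covariance `(2 b)⁻¹` times the
identity. -/
lemma stdGaussian_map_smul_eq_withDensity {b : ℝ} (hb : 0 < b) :
    (stdGaussian E).map (fun x => (√(2 * b))⁻¹ • x) = volume.withDensity fun x =>
      ENNReal.ofReal ((b / Real.pi) ^ (Module.finrank ℝ E / 2 : ℝ) *
        Real.exp (-b * ‖x‖ ^ 2)) := by
  have hpi := Real.pi_pos
  set K : ℝ := (b / Real.pi) ^ (Module.finrank ℝ E / 2 : ℝ) with hK
  have hK0 : 0 < K := by positivity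
  have hKinv : (Real.pi / b) ^ (Module.finrank ℝ E / 2 : ℝ) = K⁻¹ := by
    rw [hK, ← Real.inv_rpow (by positivity), inv_div]
  have hmeas : Measurable fun x : E => K * Real.exp (-b * ‖x‖ ^ 2) := by fun_prop
  have hint := GaussianFourier.integral_rexp_neg_mul_sq_norm (V := E) hb
  have hi : Integrable fun x : E => Real.exp (-b * ‖x‖ ^ 2) := by
    refine not_imp_comm.1 integral_undef ?_
    rw [hint]; positivity
  have : IsFiniteMeasure ((volume : Measure E).withDensity fun x =>
      ENNReal.ofReal (K * Real.exp (-b * ‖x‖ ^ 2))) :=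
    isFiniteMeasure_withDensity_ofReal (hi.const_mul K).2
  have : IsProbabilityMeasure ((stdGaussian E).map (fun x => (√(2 * b))⁻¹ • x)) :=
    Measure.isProbabilityMeasure_map (by fun_prop)
  refine Measure.ext_of_charFun ?_
  ext t
  rw [charFun_map_smul, charFun_stdGaussian, charFun_apply,
    integral_withDensity_eq_integral_toReal_smul (by fun_prop) (by simp)]
  have h1 (x : E) : (ENNReal.ofReal (K * Real.exp (-b * ‖x‖ ^ 2))).toReal •
      Complex.exp (inner ℝ x t * Complex.I)
      = (K : ℂ) * Complex.exp (-(b : ℂ) * (‖x‖ : ℂ) ^ 2 + Complex.I * inner ℝ t x) := by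
    rw [ENNReal.toReal_ofReal (by positivity), Complex.real_smul, Complex.exp_add,
      real_inner_comm]
    push_cast
    ring_nf
  simp_rw [h1]
  rw [integral_const_mul, GaussianFourier.integral_cexp_neg_mul_sq_norm_add (by simpa using hb)]
  have h2 : ((Real.pi : ℂ) / (b : ℂ)) ^ (Module.finrank ℝ E / 2 : ℂ) = ((K⁻¹ : ℝ) : ℂ) := by
    rw [← hKinv, Complex.ofReal_cpow (by positivity)]
    push_cast
    rfl
  rw [h2, ← mul_assoc, ← Complex.ofReal_mul, mul_inv_cancel₀ hK0.ne', Complex.ofReal_one, one_mul,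
    norm_smul, Real.norm_of_nonneg (by positivity)]
  congr 1
  have h3 : ((√(2 * b))⁻¹ * ‖t‖) ^ 2 = ‖t‖ ^ 2 / (2 * b) := by
    rw [mul_pow, inv_pow, Real.sq_sqrt (by positivity)]; field_simp
  rw [← Complex.ofReal_pow, h3, Complex.I_sq]
  have : (b : ℂ) ≠ 0 := by exact_mod_cast hb.ne'
  push_cast
  field_simp
  norm_num

end Density

/-- The generalized Cauchy measure as a Gaussian mixture: this is the identity
`(1 + ‖x‖²) ^ (-β) ∝ ∫ s in (0, ∞), s ^ (β - 1) * exp (-(a * s * (1 + ‖x‖²)))` with `β = a + n / 2`,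
read as a Gamma average of Gaussian densities. -/
lemma map_gamma_prod_stdGaussian (n : ℕ) {a : ℝ} (ha : 0 < a) :
    ((gammaMeasure a a).prod (stdGaussian (EuclideanSpace ℝ (Fin n)))).map
        (fun p => (√(2 * (a * p.1)))⁻¹ • p.2)
      = ENNReal.ofReal (Real.Gamma (a + n / 2) / (Real.Gamma a * Real.pi ^ (n / 2 : ℝ))) •
        cauchyWeight n (a + n / 2) := by
  set E := EuclideanSpace ℝ (Fin n)
  have := isProbabilityMeasure_gammaMeasure ha ha
  have hpi := Real.pi_pos
  have hGa := Real.Gamma_pos_of_pos ha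
  have hβ : 0 < a + n / 2 := by positivity
  have hGβ := Real.Gamma_pos_of_pos hβ
  have hmm : Measurable fun p : ℝ × E => (√(2 * (a * p.1)))⁻¹ • p.2 := by fun_prop
  refine Measure.ext_of_lintegral _ fun φ hφ => ?_
  have hφm : Measurable fun p : ℝ × E => φ ((√(2 * (a * p.1)))⁻¹ • p.2) := hφ.comp hmm
  rw [lintegral_map hφ hmm, lintegral_prod _ hφm.aemeasurable,
    lintegral_gammaMeasure hφm.lintegral_prod_right', cauchyWeight,
    lintegral_smul_measure, smul_eq_mul, lintegral_withDensity_eq_lintegral_mul _ (by fun_prop) hφ,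
    ← lintegral_const_mul' _ _ ENNReal.ofReal_ne_top]
  have h1 (s : ℝ) (hs : s ∈ Set.Ioi (0 : ℝ)) :
      ENNReal.ofReal (a ^ a / Real.Gamma a * s ^ (a - 1) * Real.exp (-(a * s))) *
        ∫⁻ y, φ ((√(2 * (a * s)))⁻¹ • y) ∂(stdGaussian E) =
      ∫⁻ x, ENNReal.ofReal (a ^ a / Real.Gamma a * s ^ (a - 1) * Real.exp (-(a * s))) *
        (ENNReal.ofReal ((a * s / Real.pi) ^ (n / 2 : ℝ) * Real.exp (-(a * s) * ‖x‖ ^ 2)) * φ x)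
        ∂(volume : Measure E) := by
    have hs' : (0 : ℝ) < s := hs
    have has : 0 < a * s := by positivity
    rw [← lintegral_map (f := φ) (g := fun y : E => (√(2 * (a * s)))⁻¹ • y) hφ (by fun_prop),
      stdGaussian_map_smul_eq_withDensity has,
      lintegral_withDensity_eq_lintegral_mul _ (by fun_prop) hφ,
      lintegral_const_mul' _ _ ENNReal.ofReal_ne_top]
    simp only [E, finrank_euclideanSpace_fin, Pi.mul_apply]
  rw [setLIntegral_congr_fun measurableSet_Ioi h1, lintegral_lintegral_swap (by fun_prop)]
  refine lintegral_congr fun x => ?_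
  have hx : 0 < 1 + ‖x‖ ^ 2 := by positivity
  have h2 (s : ℝ) (hs : s ∈ Set.Ioi (0 : ℝ)) :
      ENNReal.ofReal (a ^ a / Real.Gamma a * s ^ (a - 1) * Real.exp (-(a * s))) *
        (ENNReal.ofReal ((a * s / Real.pi) ^ (n / 2 : ℝ) * Real.exp (-(a * s) * ‖x‖ ^ 2)) * φ x)
      = ENNReal.ofReal (a ^ a / Real.Gamma a * (a / Real.pi) ^ (n / 2 : ℝ)) *
        ENNReal.ofReal (s ^ (a + n / 2 - 1) * Real.exp (-(a * (1 + ‖x‖ ^ 2) * s))) * φ x := by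
    have hs' : (0 : ℝ) < s := hs
    rw [← mul_assoc, ← ENNReal.ofReal_mul (by positivity), ← ENNReal.ofReal_mul (by positivity)]
    congr 2
    rw [show a * s / Real.pi = a / Real.pi * s by ring,
      Real.mul_rpow (by positivity) hs'.le, show a + (n : ℝ) / 2 - 1 = (a - 1) + n / 2 by ring,
      Real.rpow_add hs', show -(a * (1 + ‖x‖ ^ 2) * s) = -(a * s) + -(a * s) * ‖x‖ ^ 2 by ring,
      Real.exp_add]
    ring
  rw [setLIntegral_congr_fun measurableSet_Ioi h2, lintegral_mul_const _ (by fun_prop),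
    lintegral_const_mul' _ _ ENNReal.ofReal_ne_top,
    lintegral_rpow_mul_exp_neg_mul_Ioi hβ (by positivity), Pi.mul_apply, ← mul_assoc,
    ← ENNReal.ofReal_mul (by positivity), ← ENNReal.ofReal_mul (by positivity)]
  congr 2
  rw [Real.rpow_neg hx.le, Real.div_rpow zero_le_one (by positivity), Real.one_rpow,
    Real.mul_rpow ha.le hx.le, Real.div_rpow ha.le hpi.le, Real.rpow_add ha]
  have h3 := (Real.rpow_pos_of_pos ha a).ne'
  have h4 := (Real.rpow_pos_of_pos ha (n / 2 : ℝ)).ne'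
  have h5 := (Real.rpow_pos_of_pos hx (a + n / 2 : ℝ)).ne'
  field_simp

/-- The normalizing constant `Z`. -/
lemma cauchyWeight_univ (n : ℕ) {a : ℝ} (ha : 0 < a) :
    cauchyWeight n (a + n / 2) Set.univ
      = ENNReal.ofReal (Real.Gamma a * Real.pi ^ (n / 2 : ℝ) / Real.Gamma (a + n / 2)) := by
  have := isProbabilityMeasure_gammaMeasure ha ha
  have hpi := Real.pi_pos
  have hGa := Real.Gamma_pos_of_pos ha
  have hGβ := Real.Gamma_pos_of_pos (show 0 < a + n / 2 by positivity)
  have h : ((gammaMeasure a a).prod (stdGaussian (EuclideanSpace ℝ (Fin n)))).map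
        (fun p => (√(2 * (a * p.1)))⁻¹ • p.2) Set.univ = 1 := by
    rw [Measure.map_apply (by fun_prop) MeasurableSet.univ]
    simp
  rw [map_gamma_prod_stdGaussian n ha, Measure.smul_apply, smul_eq_mul] at h
  rw [ENNReal.eq_inv_of_mul_eq_one_left ((mul_comm _ _).trans h),
    ← ENNReal.ofReal_inv_of_pos (by positivity), inv_div]

/-- The rescaled Cauchy distribution is a multivariate Student distribution: the law of `g / √s`,
where `g` is standard Gaussian and `s` is an independent Gamma variable of mean `1`. -/
lemma rescaledCauchy_eq_map_gamma_prod_stdGaussian (n : ℕ) {β : ℝ} (hβ : (n : ℝ) / 2 < β) :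
    rescaledCauchy n β = ((gammaMeasure (β - n / 2) (β - n / 2)).prod
      (stdGaussian (EuclideanSpace ℝ (Fin n)))).map (fun p => (√p.1)⁻¹ • p.2) := by
  obtain ⟨a, rfl⟩ : ∃ a, β = a + n / 2 := ⟨β - n / 2, by ring⟩
  have ha : 0 < a := by linarith
  have hpi := Real.pi_pos
  have hGa := Real.Gamma_pos_of_pos ha
  have hGβ := Real.Gamma_pos_of_pos (show 0 < a + n / 2 by positivity)
  rw [rescaledCauchy, cauchyDistribution, cauchyWeight_univ n ha,
    ← ENNReal.ofReal_inv_of_pos (by positivity), inv_div, ← map_gamma_prod_stdGaussian n ha,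
    Measure.map_map (by fun_prop) (by fun_prop), add_sub_cancel_right]
  congr 1
  ext1 p
  simp only [Function.comp_apply, smul_smul]
  congr 1
  have : √(2 * a) ≠ 0 := by positivity
  rw [show 2 * (a + (n : ℝ) / 2) - n = 2 * a by ring, ← mul_assoc,
    Real.sqrt_mul (show 0 ≤ 2 * a by positivity) p.1, mul_inv, mul_inv_cancel_left₀ this]

/-! ### Deviations of the Gamma law and the norm of a Gaussian vector -/

/-- Chernoff's bound. -/
lemma measure_setOf_le_le_lintegral_exp {α : Type*} [MeasurableSpace α] {μ : Measure α} {X : α → ℝ}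
    (hX : Measurable X) (c : ℝ) :
    μ {s | c ≤ X s} ≤ ENNReal.ofReal (Real.exp (-c)) * ∫⁻ s, ENNReal.ofReal (Real.exp (X s)) ∂μ := by
  rw [← lintegral_indicator_one (measurableSet_le measurable_const hX),
    ← lintegral_const_mul' _ _ ENNReal.ofReal_ne_top]
  refine lintegral_mono (Set.indicator_le fun s hs => ?_)
  rw [← ENNReal.ofReal_mul (Real.exp_pos _).le, ← Real.exp_add, Pi.one_apply, ← ENNReal.ofReal_one]
  have hs' : c ≤ X s := hs
  exact ENNReal.ofReal_le_ofReal (Real.one_le_exp (by linarith))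

lemma gammaMeasure_Ici_sq_le {a w : ℝ} (ha : 0 < a) (hw : 1 ≤ w) :
    gammaMeasure a a {s | w ^ 2 ≤ s} ≤ ENNReal.ofReal (Real.exp (-(a * (w - 1) ^ 2))) := by
  have hw0 : 0 < w := by linarith
  -- the minimizer of the Chernoff bound `exp (-c w²) (1 - c / a) ^ (-a)`
  set c : ℝ := a * (1 - (w ^ 2)⁻¹) with hc
  have hc0 : 0 ≤ c := mul_nonneg ha.le (sub_nonneg.2 (inv_le_one_of_one_le₀ (one_le_pow₀ hw)))
  have hca : c < a := by
    rw [hc]; have : 0 < (w ^ 2)⁻¹ := by positivity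
    nlinarith
  have hsub : {s : ℝ | w ^ 2 ≤ s} ⊆ {s | c * w ^ 2 ≤ c * s} := fun s (hs : w ^ 2 ≤ s) =>
    mul_le_mul_of_nonneg_left hs hc0
  refine (measure_mono hsub).trans ((measure_setOf_le_le_lintegral_exp (by fun_prop) _).trans ?_)
  rw [lintegral_exp_gammaMeasure ha ha hca, ← ENNReal.ofReal_mul (Real.exp_pos _).le]
  refine ENNReal.ofReal_le_ofReal ?_
  have h1 : 1 - c / a = (w ^ 2)⁻¹ := by rw [hc]; field_simp; ring
  rw [h1, Real.rpow_def_of_pos (by positivity), ← Real.exp_add, Real.log_inv, Real.log_pow]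
  refine Real.exp_le_exp.2 ?_
  have h2 : c * w ^ 2 = a * (w ^ 2 - 1) := by rw [hc]; field_simp
  have h3 := Real.log_le_sub_one_of_pos hw0
  rw [h2]
  push_cast
  nlinarith

/-- The exact Chernoff exponent is `a` times `2 log w - 1 + w⁻²`, with `w = 1 + d`; the rational
lower bound `d² / (1 + d²)` follows from `2 d / (d + 2) ≤ log (1 + d)`. -/
lemma gammaMeasure_Iic_inv_sq_le {a d : ℝ} (ha : 0 < a) (hd : 0 ≤ d) :
    gammaMeasure a a {s | s ≤ ((1 + d) ^ 2)⁻¹} ≤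
      ENNReal.ofReal (Real.exp (-(a * (d ^ 2 / (1 + d ^ 2))))) := by
  set w : ℝ := 1 + d with hw
  have hw1 : 1 ≤ w := by linarith
  have hw0 : 0 < w := by linarith
  -- the minimizer of the Chernoff bound `exp (c / w²) (1 + c / a) ^ (-a)`
  set c : ℝ := a * (w ^ 2 - 1) with hc
  have hc0 : 0 ≤ c := mul_nonneg ha.le (sub_nonneg.2 (one_le_pow₀ hw1))
  have hsub : {s : ℝ | s ≤ (w ^ 2)⁻¹} ⊆ {s | -c * (w ^ 2)⁻¹ ≤ -c * s} :=
    fun s (hs : s ≤ (w ^ 2)⁻¹) => mul_le_mul_of_nonpos_left hs (by linarith)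
  refine (measure_mono hsub).trans ((measure_setOf_le_le_lintegral_exp (by fun_prop) _).trans ?_)
  rw [lintegral_exp_gammaMeasure ha ha (by linarith), ← ENNReal.ofReal_mul (Real.exp_pos _).le]
  refine ENNReal.ofReal_le_ofReal ?_
  have h1 : 1 - -c / a = w ^ 2 := by rw [hc]; field_simp; ring
  rw [h1, Real.rpow_def_of_pos (by positivity), ← Real.exp_add, Real.log_pow]
  refine Real.exp_le_exp.2 ?_
  have h2 : -(-c * (w ^ 2)⁻¹) = a * (1 - (w ^ 2)⁻¹) := by rw [hc]; field_simp
  have h3 : 2 * d / (d + 2) ≤ Real.log w := Real.le_log_one_add_of_nonneg hd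
  have h4 : d ^ 2 / (1 + d ^ 2) ≤ 2 * (2 * d / (d + 2)) - (1 - (w ^ 2)⁻¹) := by
    have : 2 * (2 * d / (d + 2)) - (1 - (w ^ 2)⁻¹) - d ^ 2 / (1 + d ^ 2)
        = 2 * d ^ 2 * (1 - d + d ^ 3) / ((d + 2) * w ^ 2 * (1 + d ^ 2)) := by
      rw [hw]; field_simp; ring
    have h5 : 0 ≤ 1 - d + d ^ 3 := by
      nlinarith [mul_nonneg hd (sq_nonneg (d - 1)), sq_nonneg (d - 1), sq_nonneg (3 * d - 2)]
    have h6 : 0 ≤ 2 * d ^ 2 * (1 - d + d ^ 3) / ((d + 2) * w ^ 2 * (1 + d ^ 2)) := by positivity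
    linarith
  rw [h2]
  push_cast
  nlinarith [mul_le_mul_of_nonneg_left (h4.trans (sub_le_sub_right
    (mul_le_mul_of_nonneg_left h3 zero_le_two) _)) ha.le]

lemma integrable_and_integral_eq_of_lintegral_eq {α : Type*} [MeasurableSpace α] {μ : Measure α}
    {f : α → ℝ} (hf : Measurable f) (h0 : 0 ≤ᵐ[μ] f) {c : ℝ} (hc : 0 ≤ c)
    (h : ∫⁻ x, ENNReal.ofReal (f x) ∂μ = ENNReal.ofReal c) :
    Integrable f μ ∧ ∫ x, f x ∂μ = c := by
  refine ⟨⟨hf.aestronglyMeasurable, ?_⟩, ?_⟩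
  · rw [hasFiniteIntegral_iff_ofReal h0, h]; exact ENNReal.ofReal_lt_top
  · rw [integral_eq_lintegral_of_nonneg_ae h0 hf.aestronglyMeasurable, h, ENNReal.toReal_ofReal hc]

lemma integral_id_gammaMeasure {a : ℝ} (ha : 0 < a) :
    Integrable (fun s => s) (gammaMeasure a a) ∧ ∫ s, s ∂(gammaMeasure a a) = 1 := by
  refine integrable_and_integral_eq_of_lintegral_eq measurable_id'
    ((gammaMeasure_ae_pos a a).mono fun s hs => hs.le) zero_le_one ?_
  have h := lintegral_rpow_mul_exp_gammaMeasure (p := 1) (c := 0) ha ha (by linarith) ha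
  simp only [Real.rpow_one, zero_mul, Real.exp_zero, mul_one, sub_zero] at h
  rw [h, Real.Gamma_add_one ha.ne', Real.rpow_add (by positivity), Real.rpow_one,
    Real.div_rpow zero_le_one ha.le, Real.one_rpow]
  congr 1
  have := (Real.Gamma_pos_of_pos ha).ne'
  have := (Real.rpow_pos_of_pos ha a).ne'
  field_simp

lemma integral_inv_gammaMeasure {a : ℝ} (ha : 1 < a) :
    Integrable (fun s => s⁻¹) (gammaMeasure a a) ∧
      ∫ s, s⁻¹ ∂(gammaMeasure a a) = a / (a - 1) := by
  have ha0 : 0 < a := by linarith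
  have ha1 : 0 < a - 1 := by linarith
  refine integrable_and_integral_eq_of_lintegral_eq measurable_inv
    ((gammaMeasure_ae_pos a a).mono fun s hs => (inv_pos.2 hs).le) (by positivity) ?_
  have h := lintegral_rpow_mul_exp_gammaMeasure (p := -1) (c := 0) ha0 ha0 (by linarith) ha0
  simp only [Real.rpow_neg_one, zero_mul, Real.exp_zero, mul_one, sub_zero] at h
  have hG : Real.Gamma a = (a - 1) * Real.Gamma (a - 1) := by
    rw [← Real.Gamma_add_one ha1.ne', sub_add_cancel]
  rw [h, hG, Real.rpow_add (by positivity), Real.rpow_neg_one,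
    Real.div_rpow zero_le_one ha0.le, Real.one_rpow, ← sub_eq_add_neg]
  congr 1
  have := (Real.Gamma_pos_of_pos ha1).ne'
  have := (Real.rpow_pos_of_pos ha0 a).ne'
  field_simp

lemma integrable_inv_sqrt_gammaMeasure {a : ℝ} (ha : 1 < a) :
    Integrable (fun s => (√s)⁻¹) (gammaMeasure a a) := by
  have := isProbabilityMeasure_gammaMeasure (a := a) (r := a) (by linarith) (by linarith)
  refine ((integrable_const (1 : ℝ)).add (integral_inv_gammaMeasure ha).1).mono'
    (by fun_prop) ?_
  filter_upwards [gammaMeasure_ae_pos a a] with s hs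
  rw [Real.norm_of_nonneg (by positivity), Pi.add_apply]
  have h2 : s⁻¹ = (√s)⁻¹ ^ 2 := by rw [inv_pow, Real.sq_sqrt hs.le]
  rw [h2]
  nlinarith [sq_nonneg ((√s)⁻¹ - 1), sq_nonneg (√s)⁻¹]

lemma integral_abs_inv_sqrt_sub_one_gammaMeasure_le {a : ℝ} (ha : 1 < a) :
    ∫ s, |(√s)⁻¹ - 1| ∂(gammaMeasure a a) ≤ (√(a - 1))⁻¹ := by
  have ha0 : 0 < a := by linarith
  have ha1 : 0 < a - 1 := by linarith
  have := isProbabilityMeasure_gammaMeasure ha0 ha0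
  obtain ⟨i1, e1⟩ := integral_id_gammaMeasure ha0
  obtain ⟨i2, e2⟩ := integral_inv_gammaMeasure ha
  have i0 : Integrable (fun _ : ℝ => (2 : ℝ)) (gammaMeasure a a) := integrable_const _
  have hl : 0 < √(a - 1) := Real.sqrt_pos.2 ha1
  have hl2 : √(a - 1) ^ 2 = a - 1 := Real.sq_sqrt ha1.le
  set l := √(a - 1)
  have i5 : Integrable (fun s : ℝ => s⁻¹ - 2) (gammaMeasure a a) := i2.sub i0
  have i3 : Integrable (fun s => l * (s⁻¹ - 2 + s) / 2) (gammaMeasure a a) :=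
    ((i5.add i1).const_mul l).div_const 2
  have i4 : Integrable (fun _ : ℝ => l⁻¹ / 2) (gammaMeasure a a) := integrable_const _
  calc ∫ s, |(√s)⁻¹ - 1| ∂(gammaMeasure a a)
      ≤ ∫ s, (l * (s⁻¹ - 2 + s) / 2 + l⁻¹ / 2) ∂(gammaMeasure a a) := by
        refine integral_mono_ae ?_ (i3.add i4) ?_
        · exact ((integrable_inv_sqrt_gammaMeasure ha).sub (integrable_const _)).abs
        · filter_upwards [gammaMeasure_ae_pos a a] with s hs
          have hx : 0 < √s := Real.sqrt_pos.2 hs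
          have hxs : s = √s ^ 2 := (Real.sq_sqrt hs.le).symm
          set x := √s
          -- with `z = x⁻¹ - 1`, use `z² ≤ (x⁻¹ - x)²` and `2 |z| ≤ l z² + l⁻¹`
          have h1 : (x⁻¹ - 1) ^ 2 ≤ s⁻¹ - 2 + s := by
            have : s⁻¹ - 2 + s - (x⁻¹ - 1) ^ 2 = (x - 1) ^ 2 * (x + 2) / x := by
              rw [hxs]; field_simp; ring
            have : 0 ≤ (x - 1) ^ 2 * (x + 2) / x := by positivity
            linarith
          have h2 : 2 * |x⁻¹ - 1| ≤ l * (x⁻¹ - 1) ^ 2 + l⁻¹ := by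
            have : l * (x⁻¹ - 1) ^ 2 + l⁻¹ - 2 * |x⁻¹ - 1| = (l * |x⁻¹ - 1| - 1) ^ 2 / l := by
              rw [← sq_abs (x⁻¹ - 1)]; field_simp; ring
            have : 0 ≤ (l * |x⁻¹ - 1| - 1) ^ 2 / l := by positivity
            linarith
          have h3 := mul_le_mul_of_nonneg_left h1 hl.le
          linarith
    _ = l⁻¹ := by
        rw [integral_add i3 i4, integral_div, integral_const_mul, integral_add i5 i1,
          integral_sub i2 i0, e1, e2]
        simp only [integral_const, probReal_univ, smul_eq_mul, one_mul]
        have h4 : a / (a - 1) - 2 + 1 = (l ^ 2)⁻¹ := by rw [hl2]; field_simp; ring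
        rw [h4]; field_simp; norm_num

lemma integral_norm_stdGaussian_le (n : ℕ) :
    ∫ x, ‖x‖ ∂(stdGaussian (EuclideanSpace ℝ (Fin n))) ≤ √n := by
  set E := EuclideanSpace ℝ (Fin n)
  set γ := stdGaussian E
  have hL2 : MemLp (fun x : E => ‖x‖) 2 γ := (IsGaussian.memLp_two_id (μ := γ)).norm
  have h1 : ∫ x, ‖x‖ ^ 2 ∂γ ≤ n := by
    have hc (i : Fin n) : Integrable (fun x : E => (EuclideanSpace.proj i : E →L[ℝ] ℝ) x ^ 2) γ :=
      (IsGaussian.memLp_dual γ _ 2 (by simp)).integrable_sq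
    have hv (i : Fin n) : ∫ x, (EuclideanSpace.proj i : E →L[ℝ] ℝ) x ^ 2 ∂γ ≤ 1 := by
      have h2 := variance_dual_stdGaussian (EuclideanSpace.proj i : E →L[ℝ] ℝ)
      rw [variance_of_integral_eq_zero (by fun_prop) (integral_strongDual_stdGaussian _)] at h2
      rw [h2]
      refine pow_le_one₀ (norm_nonneg _) ?_
      refine ContinuousLinearMap.opNorm_le_bound _ zero_le_one fun x => ?_
      rw [one_mul]
      exact PiLp.norm_apply_le x i
    have h3 (x : E) : ‖x‖ ^ 2 = ∑ i, (EuclideanSpace.proj i : E →L[ℝ] ℝ) x ^ 2 :=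
      (EuclideanSpace.norm_sq_eq x).trans (by simp)
    simp_rw [h3]
    rw [integral_finsetSum _ fun i _ => hc i]
    exact (Finset.sum_le_sum fun i _ => hv i).trans (by simp)
  refine Real.le_sqrt_of_sq_le (le_trans ?_ h1)
  have h4 := variance_nonneg (fun x : E => ‖x‖) γ
  rw [variance_eq_sub hL2] at h4
  simpa using h4

/-! ### Concentration of the mixture -/

section Mixture

variable {n : ℕ} {f : EuclideanSpace ℝ (Fin n) → ℝ}

lemma lipschitzWith_comp_smul (hf : LipschitzWith 1 f) {c : ℝ} (hc : 0 ≤ c) :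
    LipschitzWith c.toNNReal fun x => f (c • x) := by
  refine LipschitzWith.of_dist_le_mul fun x y => ?_
  refine (hf.dist_le_mul _ _).trans ?_
  rw [NNReal.coe_one, one_mul, Real.coe_toNNReal _ hc, dist_smul₀, Real.norm_of_nonneg hc]

lemma integrable_comp_smul_gamma_prod_stdGaussian (hf : LipschitzWith 1 f) {a : ℝ} (ha : 1 < a) :
    Integrable (fun p : ℝ × EuclideanSpace ℝ (Fin n) => f ((√p.1)⁻¹ • p.2))
      ((gammaMeasure a a).prod (stdGaussian (EuclideanSpace ℝ (Fin n)))) := by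
  have := isProbabilityMeasure_gammaMeasure (a := a) (r := a) (by linarith) (by linarith)
  have hfc := hf.continuous.measurable
  have h1 := (integrable_inv_sqrt_gammaMeasure ha).mul_prod
    (IsGaussian.integrable_id (μ := stdGaussian (EuclideanSpace ℝ (Fin n)))).norm
  refine ((integrable_const |f 0|).add h1).mono' ?_ (Filter.Eventually.of_forall fun p => ?_)
  · exact (hfc.comp (by fun_prop)).aestronglyMeasurable
  · have h2 := hf.dist_le_mul ((√p.1)⁻¹ • p.2) 0
    rw [dist_zero_right, Real.dist_eq, norm_smul, Real.norm_of_nonneg (by positivity),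
      NNReal.coe_one, one_mul] at h2
    rw [Real.norm_eq_abs]
    simp only [Pi.add_apply, id]
    linarith [abs_sub_abs_le_abs_sub (f ((√p.1)⁻¹ • p.2)) (f 0)]

lemma abs_integral_comp_smul_sub_le (hf : LipschitzWith 1 f) {c d : ℝ} (hc : 0 ≤ c) (hd : 0 ≤ d) :
    |∫ x, f (c • x) ∂(stdGaussian (EuclideanSpace ℝ (Fin n))) -
      ∫ x, f (d • x) ∂(stdGaussian (EuclideanSpace ℝ (Fin n)))| ≤ √n * |c - d| := by
  set γ := stdGaussian (EuclideanSpace ℝ (Fin n))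
  rw [← integral_sub (lipschitzWith_comp_smul hf hc).integrable_stdGaussian
    (lipschitzWith_comp_smul hf hd).integrable_stdGaussian, ← Real.norm_eq_abs]
  calc ‖∫ x, (f (c • x) - f (d • x)) ∂γ‖ ≤ ∫ x, |c - d| * ‖x‖ ∂γ := by
        refine norm_integral_le_of_norm_le ((IsGaussian.integrable_id (μ := γ)).norm.const_mul _)
          (Filter.Eventually.of_forall fun x => ?_)
        have h := hf.dist_le_mul (c • x) (d • x)
        rwa [NNReal.coe_one, one_mul, dist_eq_norm, dist_eq_norm, ← sub_smul, norm_smul,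
          Real.norm_eq_abs (c - d)] at h
    _ ≤ √n * |c - d| := by
        rw [integral_const_mul, mul_comm]
        exact mul_le_mul_of_nonneg_right (integral_norm_stdGaussian_le n) (abs_nonneg _)

/-- If the mixture mean of `f` vanishes, then the conditional mean of `f` given the mixing variable
`s` is controlled by `|s ^ (-1/2) - 1|` up to the dimension-free constant `√2`. -/
lemma abs_integral_comp_inv_sqrt_smul_le (hf : LipschitzWith 1 f) {a : ℝ} (ha : 1 < a)
    (hna : (n : ℝ) ≤ 2 * (a - 1))
    (hmean : ∫ p, f ((√p.1)⁻¹ • p.2)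
      ∂((gammaMeasure a a).prod (stdGaussian (EuclideanSpace ℝ (Fin n)))) = 0) (s : ℝ) :
    |∫ x, f ((√s)⁻¹ • x) ∂(stdGaussian (EuclideanSpace ℝ (Fin n)))|
      ≤ √n * |(√s)⁻¹ - 1| + √2 := by
  have := isProbabilityMeasure_gammaMeasure (a := a) (r := a) (by linarith) (by linarith)
  set γ := stdGaussian (EuclideanSpace ℝ (Fin n))
  set m : ℝ → ℝ := fun s => ∫ x, f ((√s)⁻¹ • x) ∂γ
  have hint := integrable_comp_smul_gamma_prod_stdGaussian hf ha
  have hmi : Integrable m (gammaMeasure a a) := hint.integral_prod_left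
  rw [integral_prod _ hint] at hmean
  have hai : Integrable (fun s' => |(√s')⁻¹ - 1|) (gammaMeasure a a) :=
    ((integrable_inv_sqrt_gammaMeasure ha).sub (integrable_const _)).abs
  have hbi : Integrable (fun s' => √n * (|(√s)⁻¹ - 1| + |(√s')⁻¹ - 1|)) (gammaMeasure a a) :=
    ((integrable_const _).add hai).const_mul _
  have h1 : m s = ∫ s', (m s - m s') ∂(gammaMeasure a a) := by
    have hm0 : ∫ s', m s' ∂(gammaMeasure a a) = 0 := hmean
    rw [integral_sub (integrable_const _) hmi, hm0]
    simp
  change |m s| ≤ _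
  rw [h1, ← Real.norm_eq_abs]
  refine (norm_integral_le_of_norm_le hbi (Filter.Eventually.of_forall fun s' => ?_)).trans ?_
  · rw [Real.norm_eq_abs]
    refine (abs_integral_comp_smul_sub_le hf (by positivity) (by positivity)).trans ?_
    refine mul_le_mul_of_nonneg_left ?_ (Real.sqrt_nonneg _)
    rw [show (√s)⁻¹ - (√s')⁻¹ = ((√s)⁻¹ - 1) - ((√s')⁻¹ - 1) by ring]
    exact abs_sub _ _
  · rw [integral_const_mul, integral_add (integrable_const _) hai, integral_const, probReal_univ,
      one_smul, mul_add]
    gcongr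
    have ha1 : 0 < √(a - 1) := Real.sqrt_pos.2 (by linarith)
    calc √n * ∫ s', |(√s')⁻¹ - 1| ∂(gammaMeasure a a)
        ≤ √(2 * (a - 1)) * (√(a - 1))⁻¹ := by
          refine mul_le_mul (Real.sqrt_le_sqrt hna)
            (integral_abs_inv_sqrt_sub_one_gammaMeasure_le ha)
            (integral_nonneg fun _ => abs_nonneg _) (Real.sqrt_nonneg _)
      _ = √2 := by
          rw [Real.sqrt_mul zero_le_two, mul_inv_cancel_right₀ ha1.ne']

/-- Tail bound for the mixture. Outside the Gamma event that `√s` leaves `((1 + d)⁻¹, 1 + d)`, the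
conditional mean is at most `t / 2`, and Gaussian concentration applies to the deviation from it;
averaging the resulting bound over `s` gives the Laplace transform of the Gamma law. -/
lemma gamma_prod_stdGaussian_tail_le (hf : LipschitzWith 1 f) {a : ℝ} (ha : 1 < a)
    (hna : (n : ℝ) ≤ 2 * (a - 1))
    (hmean : ∫ p, f ((√p.1)⁻¹ • p.2)
      ∂((gammaMeasure a a).prod (stdGaussian (EuclideanSpace ℝ (Fin n)))) = 0)
    {t d : ℝ} (hd : 0 ≤ d) (ht : √n * d + √2 ≤ t / 2) :
    ((gammaMeasure a a).prod (stdGaussian (EuclideanSpace ℝ (Fin n))))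
        {p | t ≤ |f ((√p.1)⁻¹ • p.2)|}
      ≤ ENNReal.ofReal (2 * (1 + t ^ 2 / (2 * Real.pi ^ 2 * a)) ^ (-a) +
          2 * Real.exp (-(a * (d ^ 2 / (1 + d ^ 2))))) := by
  have ha0 : 0 < a := by linarith
  have := isProbabilityMeasure_gammaMeasure ha0 ha0
  have hpi := Real.pi_pos
  have ht0 : 0 ≤ t := by
    have : 0 ≤ √n * d + √2 := by positivity
    linarith
  set γ := stdGaussian (EuclideanSpace ℝ (Fin n))
  have hfm := hf.continuous.measurable
  have hms : MeasurableSet {p : ℝ × EuclideanSpace ℝ (Fin n) | t ≤ |f ((√p.1)⁻¹ • p.2)|} :=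
    measurableSet_le measurable_const (measurable_abs.comp (hfm.comp (by fun_prop)))
  set U : Set ℝ := {s | (1 + d) ^ 2 ≤ s}
  set V : Set ℝ := {s | s ≤ ((1 + d) ^ 2)⁻¹}
  have hU : MeasurableSet U := measurableSet_Ici
  have hV : MeasurableSet V := measurableSet_Iic
  have hfiber : ∀ᵐ s ∂(gammaMeasure a a), γ {x | t ≤ |f ((√s)⁻¹ • x)|} ≤
      ENNReal.ofReal 2 * ENNReal.ofReal (Real.exp (-(t ^ 2 / (2 * Real.pi ^ 2)) * s)) +
        (U.indicator 1 s + V.indicator 1 s) := by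
    filter_upwards [gammaMeasure_ae_pos a a] with s hs
    by_cases hsU : s ∈ U
    · refine prob_le_one.trans ?_
      rw [Set.indicator_of_mem hsU]
      exact le_add_left le_self_add
    by_cases hsV : s ∈ V
    · refine prob_le_one.trans ?_
      rw [Set.indicator_of_mem hsV]
      exact le_add_left le_add_self
    have hsU' : s < (1 + d) ^ 2 := not_le.1 hsU
    have hsV' : ((1 + d) ^ 2)⁻¹ < s := not_le.1 hsV
    have hx : 0 < √s := Real.sqrt_pos.2 hs
    have hx1 : √s < 1 + d := by
      rw [Real.sqrt_lt' (by linarith)]; exact hsU'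
    have hx2 : (1 + d)⁻¹ < √s := by
      rw [Real.lt_sqrt (by positivity), inv_pow]; exact hsV'
    have hx3 : (√s)⁻¹ < 1 + d := inv_lt_of_inv_lt₀ (by linarith) hx2
    have hx4 : 1 - d ≤ (√s)⁻¹ := by
      rw [inv_eq_one_div, le_div_iff₀ hx]
      rcases le_total d 1 with h | h
      · nlinarith [mul_le_mul_of_nonneg_left hx1.le (sub_nonneg.2 h), sq_nonneg d]
      · nlinarith
    have habs : |(√s)⁻¹ - 1| ≤ d := abs_le.2 ⟨by linarith, by linarith⟩
    have hm := abs_integral_comp_inv_sqrt_smul_le hf ha hna hmean s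
    have hm' : |∫ x, f ((√s)⁻¹ • x) ∂γ| ≤ t / 2 :=
      hm.trans (le_trans (by gcongr) ht)
    have hc0 : 0 < (√s)⁻¹ := inv_pos.2 hx
    have hsub : {x | t ≤ |f ((√s)⁻¹ • x)|} ⊆
        {x | t / 2 ≤ |f ((√s)⁻¹ • x) - ∫ y, f ((√s)⁻¹ • y) ∂γ|} := by
      intro x hxt
      have h1 : t ≤ |f ((√s)⁻¹ • x)| := hxt
      have h2 := abs_sub_abs_le_abs_sub (f ((√s)⁻¹ • x)) (∫ y, f ((√s)⁻¹ • y) ∂γ)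
      change t / 2 ≤ _
      linarith
    refine (measure_mono hsub).trans (le_trans ?_ le_self_add)
    refine (stdGaussian_le_abs_sub_integral_le (Real.toNNReal_pos.2 hc0)
      (lipschitzWith_comp_smul hf hc0.le) (by positivity)).trans (le_of_eq ?_)
    rw [← ENNReal.ofReal_mul zero_le_two, Real.coe_toNNReal _ hc0.le, inv_pow, Real.sq_sqrt hs.le]
    congr 3
    field_simp
  rw [Measure.prod_apply hms]
  refine (lintegral_mono_ae hfiber).trans ?_
  rw [lintegral_add_left (by fun_prop), lintegral_const_mul' _ _ ENNReal.ofReal_ne_top,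
    lintegral_add_left (measurable_one.indicator hU), lintegral_indicator_one hU,
    lintegral_indicator_one hV, lintegral_exp_gammaMeasure ha0 ha0
      (lt_of_le_of_lt (neg_nonpos.2 (by positivity)) ha0), ← ENNReal.ofReal_mul zero_le_two]
  have hU' : gammaMeasure a a U ≤ ENNReal.ofReal (Real.exp (-(a * (d ^ 2 / (1 + d ^ 2))))) := by
    refine (gammaMeasure_Ici_sq_le ha0 (by linarith)).trans ?_
    rw [add_sub_cancel_left]
    refine ENNReal.ofReal_le_ofReal (Real.exp_le_exp.2 (neg_le_neg ?_))
    refine mul_le_mul_of_nonneg_left (div_le_self (sq_nonneg d) ?_) ha0.le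
    nlinarith [sq_nonneg d]
  refine (add_le_add le_rfl (add_le_add hU' (gammaMeasure_Iic_inv_sq_le ha0 hd))).trans ?_
  rw [← ENNReal.ofReal_add (Real.exp_pos _).le (Real.exp_pos _).le,
    ← ENNReal.ofReal_add _ (by positivity)]
  · refine ENNReal.ofReal_le_ofReal (le_of_eq ?_)
    rw [two_mul (Real.exp _)]
    congr 3
    field_simp
    ring
  · have : 0 ≤ 1 - -(t ^ 2 / (2 * Real.pi ^ 2)) / a := by
      rw [neg_div, sub_neg_eq_add]; positivity
    positivity

end Mixture

/-! ### The sub-Gaussian and the polynomial tail -/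

lemma isProbabilityMeasure_rescaledCauchy {n : ℕ} {β : ℝ} (hβ : (n : ℝ) / 2 < β) :
    IsProbabilityMeasure (rescaledCauchy n β) := by
  have ha : 0 < β - n / 2 := by linarith
  have := isProbabilityMeasure_gammaMeasure ha ha
  rw [rescaledCauchy_eq_map_gamma_prod_stdGaussian n hβ]
  exact Measure.isProbabilityMeasure_map (by fun_prop)

lemma one_add_rpow_neg_le_exp_neg {a q : ℝ} (ha : 0 < a) (hq : 0 ≤ q) (hqa : q ≤ a) :
    (1 + 8 * Real.exp 1 * q / (Real.pi ^ 2 * a)) ^ (-a) ≤ Real.exp (-q) := by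
  have hpi := Real.pi_pos
  have hx0 : 0 ≤ q / a := by positivity
  have hx1 : q / a ≤ 1 := (div_le_one ha).2 hqa
  -- convexity of `exp` on `[0, 1]`
  have h1 : Real.exp (q / a) ≤ 1 + (Real.exp 1 - 1) * (q / a) := by
    have := convexOn_exp.2 (Set.mem_univ 0) (Set.mem_univ 1) (sub_nonneg.2 hx1) hx0 (by ring)
    simp only [smul_eq_mul, mul_zero, mul_one, zero_add, Real.exp_zero] at this
    linarith
  have h2 : Real.exp 1 - 1 ≤ 8 * Real.exp 1 / Real.pi ^ 2 := by
    rw [le_div_iff₀ (by positivity)]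
    have := Real.exp_one_lt_d9
    have := Real.exp_one_gt_d9
    have : Real.pi ^ 2 ≤ 10 := by nlinarith [Real.pi_lt_d2]
    nlinarith
  have h3 : Real.exp (q / a) ≤ 1 + 8 * Real.exp 1 * q / (Real.pi ^ 2 * a) := by
    refine h1.trans ?_
    rw [show 8 * Real.exp 1 * q / (Real.pi ^ 2 * a) = 8 * Real.exp 1 / Real.pi ^ 2 * (q / a) by
      field_simp]
    gcongr
  calc (1 + 8 * Real.exp 1 * q / (Real.pi ^ 2 * a)) ^ (-a)
      ≤ Real.exp (q / a) ^ (-a) :=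
        Real.rpow_le_rpow_of_nonpos (Real.exp_pos _) h3 (by linarith)
    _ = Real.exp (-q) := by
        rw [← Real.exp_mul]; congr 1; field_simp

/-- The sub-Gaussian regime. The parameter `q` stands for `t² / (16 e)`. The bound is trivial for
`q ≤ 2 log 2`; beyond, the three terms in the tail bound of the mixture add up to at most
`4 exp (-q)`, which is below `2 exp (-(q / 2))` exactly when `q ≥ 2 log 2`. -/
lemma rescaledCauchy_gaussian_range {n : ℕ} (hn : 1 ≤ n) {β : ℝ} (hβ : (n : ℝ) + 1 ≤ β)
    {f : EuclideanSpace ℝ (Fin n) → ℝ} (hf : LipschitzWith 1 f)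
    (hmean : ∫ x, f x ∂(rescaledCauchy n β) = 0) {q t : ℝ} (hq : q ≤ β - 3 / 4 * n)
    (ht : 4 * √(Real.exp 1 * q) ≤ t) :
    rescaledCauchy n β {x | t ≤ |f x|} ≤ ENNReal.ofReal (2 * Real.exp (-(q / 2))) := by
  have hn' : (1 : ℝ) ≤ n := by exact_mod_cast hn
  have hβ' : (n : ℝ) / 2 < β := by linarith
  have hprob := isProbabilityMeasure_rescaledCauchy hβ'
  have he := Real.exp_one_gt_d9
  have hl := Real.log_two_gt_d9
  rcases le_or_gt q (2 * Real.log 2) with hq2 | hq2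
  · refine prob_le_one.trans ?_
    rw [← ENNReal.ofReal_one]
    refine ENNReal.ofReal_le_ofReal ?_
    have : Real.exp (-Real.log 2) ≤ Real.exp (-(q / 2)) := Real.exp_le_exp.2 (by linarith)
    rw [Real.exp_neg, Real.exp_log zero_lt_two] at this
    linarith
  have hq0 : 0 < q := by linarith
  obtain ⟨a, rfl⟩ : ∃ a, β = a + n / 2 := ⟨β - n / 2, by ring⟩
  have ha : 1 < a := by linarith
  have hna : (n : ℝ) ≤ 2 * (a - 1) := by linarith
  have hqa : (n : ℝ) ≤ 4 * (a - q) := by linarith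
  have hms : MeasurableSet {x | 4 * √(Real.exp 1 * q) ≤ |f x|} :=
    measurableSet_le measurable_const (measurable_abs.comp hf.continuous.measurable)
  have hmm : Measurable fun p : ℝ × EuclideanSpace ℝ (Fin n) => (√p.1)⁻¹ • p.2 := by fun_prop
  rw [rescaledCauchy_eq_map_gamma_prod_stdGaussian n hβ', add_sub_cancel_right] at hmean ⊢
  rw [integral_map hmm.aemeasurable hf.continuous.aestronglyMeasurable] at hmean
  have hsub : {x | t ≤ |f x|} ⊆ {x | 4 * √(Real.exp 1 * q) ≤ |f x|} :=
    fun x (hx : t ≤ |f x|) => ht.trans hx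
  refine (measure_mono hsub).trans ?_
  rw [Measure.map_apply hmm hms]
  -- `d² = 4 q / n` leaves room for the shift `√2` of the conditional mean
  set d : ℝ := 2 * √q / √n with hd
  have hsn : 0 < √(n : ℝ) := Real.sqrt_pos.2 (by linarith)
  have hd0 : 0 ≤ d := by positivity
  have hsq : 0 < √q := Real.sqrt_pos.2 hq0
  have hqs : √q ^ 2 = q := Real.sq_sqrt hq0.le
  have hd2 : d ^ 2 * n = 4 * q := by
    rw [hd, div_pow, mul_pow, hqs, Real.sq_sqrt (by positivity)]
    field_simp
    norm_num
  have htd : √n * d + √2 ≤ 4 * √(Real.exp 1 * q) / 2 := by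
    rw [hd, mul_div_cancel₀ _ hsn.ne', Real.sqrt_mul (Real.exp_pos 1).le]
    have h1 : (1.64 : ℝ) ≤ √(Real.exp 1) := Real.le_sqrt_of_sq_le (by norm_num at he ⊢; linarith)
    have h2 : √2 ≤ 1.28 * √q := by
      rw [Real.sqrt_le_left (by positivity), mul_pow, hqs]
      norm_num at hl ⊢; linarith
    nlinarith
  refine (gamma_prod_stdGaussian_tail_le hf ha hna hmean hd0 htd).trans ?_
  refine ENNReal.ofReal_le_ofReal ?_
  have h1 : (1 + (4 * √(Real.exp 1 * q)) ^ 2 / (2 * Real.pi ^ 2 * a)) ^ (-a) ≤ Real.exp (-q) := by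
    refine le_of_eq_of_le ?_ (one_add_rpow_neg_le_exp_neg (a := a) (by linarith)
      hq0.le (by linarith))
    rw [mul_pow, Real.sq_sqrt (by positivity)]
    congr 2
    have := Real.pi_pos.ne'
    field_simp
    norm_num
  have h2 : Real.exp (-(a * (d ^ 2 / (1 + d ^ 2)))) ≤ Real.exp (-q) := by
    refine Real.exp_le_exp.2 (neg_le_neg ?_)
    rw [← mul_div_assoc, le_div_iff₀ (by positivity)]
    have h3 : n * q ≤ n * ((a - q) * d ^ 2) := by
      calc n * q ≤ 4 * (a - q) * q := by gcongr
        _ = (a - q) * (d ^ 2 * n) := by rw [hd2]; ring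
        _ = _ := by ring
    have h4 := le_of_mul_le_mul_left h3 (by linarith)
    linarith
  have h5 : Real.exp (-q) ≤ Real.exp (-(q / 2)) / 2 := by
    have h6 : Real.exp (-(q / 2)) ≤ Real.exp (-Real.log 2) := Real.exp_le_exp.2 (by linarith)
    rw [Real.exp_neg, Real.exp_neg, Real.exp_log zero_lt_two] at h6
    rw [show -q = -(q / 2) + -(q / 2) by ring, Real.exp_add]
    have := Real.exp_pos (-(q / 2))
    rw [← Real.exp_neg] at h6
    nlinarith
  linarith

lemma Gamma_div_Gamma_add_le {a b : ℝ} (ha : 0 < a) (hb : 0 ≤ b) (hba : b ≤ 2 * a) (k : ℕ) :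
    Real.Gamma a / Real.Gamma (a + b) ≤
      3 ^ k * (Real.Gamma (a + k) / Real.Gamma (a + k + b)) := by
  induction k with
  | zero => simp
  | succ k ih =>
    refine ih.trans ?_
    rw [pow_succ, mul_assoc]
    refine mul_le_mul_of_nonneg_left ?_ (by positivity)
    have hak : 0 < a + k := by positivity
    have h1 : Real.Gamma (a + (k + 1 : ℕ)) = (a + k) * Real.Gamma (a + k) := by
      rw [← Real.Gamma_add_one hak.ne']; push_cast; ring_nf
    have h2 : Real.Gamma (a + (k + 1 : ℕ) + b) = (a + k + b) * Real.Gamma (a + k + b) := by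
      rw [← Real.Gamma_add_one (by positivity)]; push_cast; ring_nf
    have g1 := Real.Gamma_pos_of_pos hak
    have g2 := Real.Gamma_pos_of_pos (show 0 < a + k + b by positivity)
    rw [h1, h2, ← mul_div_assoc, div_le_div_iff₀ g2 (by positivity)]
    have h3 : a + k + b ≤ 3 * (a + k) := by linarith [Nat.cast_nonneg (α := ℝ) k]
    nlinarith [mul_le_mul_of_nonneg_right h3 (mul_pos g1 g2).le]

/-- Multiplying by `(1 + ‖x‖²) ^ k` turns the parameter `β` into `β - k`, so this moment is a ratio of
normalizing constants; each unit step of the parameter contributes a factor of at most `3`, as long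
as the smaller parameter is at least `3 n / 4`. -/
lemma lintegral_one_add_norm_sq_pow_cauchyDistribution_le {n : ℕ} (hn : 1 ≤ n) {β : ℝ} {k : ℕ}
    (hk : k ≤ β - 3 / 4 * n) :
    ∫⁻ x, ENNReal.ofReal ((1 + ‖x‖ ^ 2) ^ k) ∂(cauchyDistribution n β) ≤ ENNReal.ofReal (3 ^ k) := by
  have hn' : (1 : ℝ) ≤ n := by exact_mod_cast hn
  obtain ⟨a, rfl⟩ : ∃ a, β = a + k + n / 2 := ⟨β - n / 2 - k, by ring⟩
  have ha : 0 < a := by linarith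
  have hak : 0 < a + k := by positivity
  have hpi := Real.pi_pos
  have g1 := Real.Gamma_pos_of_pos hak
  have g2 := Real.Gamma_pos_of_pos (show 0 < a + k + n / 2 by positivity)
  have h1 : ∫⁻ x, ENNReal.ofReal ((1 + ‖x‖ ^ 2) ^ k) ∂(cauchyWeight n (a + k + n / 2))
      = cauchyWeight n (a + n / 2) Set.univ := by
    rw [cauchyWeight, cauchyWeight, lintegral_withDensity_eq_lintegral_mul _ (by fun_prop)
      (by fun_prop), withDensity_apply _ MeasurableSet.univ, setLIntegral_univ]
    refine lintegral_congr fun x => ?_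
    have hx : 0 < 1 + ‖x‖ ^ 2 := by positivity
    rw [Pi.mul_apply, ← ENNReal.ofReal_mul (by positivity), ← Real.rpow_natCast (1 + ‖x‖ ^ 2) k,
      ← Real.rpow_add hx]
    congr 2
    ring
  rw [cauchyDistribution, lintegral_smul_measure, h1, cauchyWeight_univ n ha,
    cauchyWeight_univ n hak, ← ENNReal.ofReal_inv_of_pos (by positivity), smul_eq_mul,
    ← ENNReal.ofReal_mul (by positivity)]
  refine ENNReal.ofReal_le_ofReal ?_
  have h2 := Gamma_div_Gamma_add_le ha (b := n / 2) (by positivity) (by linarith) k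
  rw [inv_mul_le_iff₀ (by positivity)]
  calc Real.Gamma a * Real.pi ^ (n / 2 : ℝ) / Real.Gamma (a + n / 2)
      = Real.pi ^ (n / 2 : ℝ) * (Real.Gamma a / Real.Gamma (a + n / 2)) := by ring
    _ ≤ Real.pi ^ (n / 2 : ℝ) * (3 ^ k * (Real.Gamma (a + k) / Real.Gamma (a + k + n / 2))) := by
        gcongr
    _ = _ := by ring

lemma lintegral_norm_pow_rescaledCauchy_le {n : ℕ} (hn : 1 ≤ n) {β : ℝ} {k : ℕ}
    (hk : k ≤ β - 3 / 4 * n) :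
    ∫⁻ x, ENNReal.ofReal (‖x‖ ^ (2 * k)) ∂(rescaledCauchy n β)
      ≤ ENNReal.ofReal ((6 * (β - n / 2)) ^ k) := by
  have h0 : 0 ≤ 2 * β - n := by
    have : (0 : ℝ) ≤ k := by positivity
    have : (1 : ℝ) ≤ n := by exact_mod_cast hn
    linarith
  rw [rescaledCauchy, lintegral_map (by fun_prop) (by fun_prop)]
  calc ∫⁻ x, ENNReal.ofReal (‖√(2 * β - n) • x‖ ^ (2 * k)) ∂(cauchyDistribution n β)
      ≤ ∫⁻ x, ENNReal.ofReal ((2 * β - n) ^ k) * ENNReal.ofReal ((1 + ‖x‖ ^ 2) ^ k)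
          ∂(cauchyDistribution n β) := by
        refine lintegral_mono fun x => ?_
        rw [← ENNReal.ofReal_mul (by positivity)]
        refine ENNReal.ofReal_le_ofReal ?_
        rw [norm_smul, Real.norm_of_nonneg (Real.sqrt_nonneg _), pow_mul, mul_pow,
          Real.sq_sqrt h0, mul_pow]
        gcongr
        linarith
    _ ≤ ENNReal.ofReal ((2 * β - n) ^ k) * ENNReal.ofReal (3 ^ k) := by
        rw [lintegral_const_mul' _ _ ENNReal.ofReal_ne_top]
        gcongr
        exact lintegral_one_add_norm_sq_pow_cauchyDistribution_le hn hk
    _ = _ := by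
        rw [← ENNReal.ofReal_mul (by positivity), ← mul_pow]
        congr 2; ring

lemma abs_zero_le_of_integral_rescaledCauchy_eq_zero {n : ℕ} (hn : 1 ≤ n) {β : ℝ}
    (hβ : (n : ℝ) + 1 ≤ β)
    {f : EuclideanSpace ℝ (Fin n) → ℝ} (hf : LipschitzWith 1 f)
    (hmean : ∫ x, f x ∂(rescaledCauchy n β) = 0) :
    |f 0| ≤ √(6 * (β - n / 2)) := by
  have hn' : (1 : ℝ) ≤ n := by exact_mod_cast hn
  have hprob := isProbabilityMeasure_rescaledCauchy (n := n) (β := β) (by linarith)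
  set μ := rescaledCauchy n β
  have h1 := lintegral_norm_pow_rescaledCauchy_le (k := 1) hn (β := β) (by push_cast; linarith)
  have hM : 0 ≤ 6 * (β - (n : ℝ) / 2) := by linarith
  rw [mul_one, pow_one] at h1
  have hi2 : Integrable (fun x : EuclideanSpace ℝ (Fin n) => ‖x‖ ^ 2) μ := by
    refine ⟨by fun_prop, ?_⟩
    rw [hasFiniteIntegral_iff_ofReal (Filter.Eventually.of_forall fun x => by positivity)]
    exact h1.trans_lt ENNReal.ofReal_lt_top
  have hL2 : MemLp (fun x : EuclideanSpace ℝ (Fin n) => ‖x‖) 2 μ :=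
    (memLp_two_iff_integrable_sq (by fun_prop)).2 hi2
  have hi1 : Integrable (fun x : EuclideanSpace ℝ (Fin n) => ‖x‖) μ :=
    hL2.integrable one_le_two
  have hfb (x : EuclideanSpace ℝ (Fin n)) : |f 0 - f x| ≤ ‖x‖ := by
    have := hf.dist_le_mul 0 x
    rwa [Real.dist_eq, dist_zero_left, NNReal.coe_one, one_mul] at this
  have hfi : Integrable f μ := by
    have h2 : Integrable (fun x => f 0 - f x) μ :=
      hi1.mono' (hf.continuous.measurable.const_sub _).aestronglyMeasurable
        (Filter.Eventually.of_forall hfb)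
    exact ((integrable_const (f 0)).sub h2).congr (Filter.Eventually.of_forall fun x => by simp)
  have h3 : f 0 = ∫ x, (f 0 - f x) ∂μ := by
    rw [integral_sub (integrable_const _) hfi, hmean]; simp
  have h4 : |f 0| ≤ ∫ x, ‖x‖ ∂μ := by
    rw [h3, ← Real.norm_eq_abs]
    exact norm_integral_le_of_norm_le hi1 (Filter.Eventually.of_forall hfb)
  refine h4.trans (Real.le_sqrt_of_sq_le ?_)
  have h5 : ∫ x, ‖x‖ ^ 2 ∂μ ≤ 6 * (β - n / 2) := by
    rw [integral_eq_lintegral_of_nonneg_ae (Filter.Eventually.of_forall fun x => by positivity)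
      (by fun_prop)]
    exact ENNReal.toReal_le_of_le_ofReal hM h1
  have h6 := variance_nonneg (fun x : EuclideanSpace ℝ (Fin n) => ‖x‖) μ
  rw [variance_eq_sub hL2] at h6
  simp only [Pi.pow_apply] at h6
  linarith

/-- Markov's inequality for the moment of order `2 k`, which is estimated by that of `‖x‖ + |f 0|`. -/
lemma rescaledCauchy_polynomial_tail {n : ℕ} (hn : 1 ≤ n) {β : ℝ} (hβ : (n : ℝ) + 1 ≤ β)
    {f : EuclideanSpace ℝ (Fin n) → ℝ} (hf : LipschitzWith 1 f)
    (hmean : ∫ x, f x ∂(rescaledCauchy n β) = 0) {k : ℕ} (hk1 : 1 ≤ k) (hk : k ≤ β - 3 / 4 * n)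
    {t : ℝ} (ht : 0 < t) :
    rescaledCauchy n β {x | t ≤ |f x|} ≤
      ENNReal.ofReal ((24 * (β - n / 2) / t ^ 2) ^ k) := by
  have hn' : (1 : ℝ) ≤ n := by exact_mod_cast hn
  have hprob := isProbabilityMeasure_rescaledCauchy (n := n) (β := β) (by linarith)
  have hf0 := abs_zero_le_of_integral_rescaledCauchy_eq_zero hn hβ hf hmean
  set μ := rescaledCauchy n β
  set M : ℝ := 6 * (β - n / 2) with hMdef
  have hM : 0 ≤ M := by rw [hMdef]; linarith
  have hfb (x : EuclideanSpace ℝ (Fin n)) : |f x| ≤ ‖x‖ + √M := by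
    have := hf.dist_le_mul x 0
    rw [Real.dist_eq, dist_zero_right, NNReal.coe_one, one_mul] at this
    linarith [abs_sub_abs_le_abs_sub (f x) (f 0)]
  have hpow (x : EuclideanSpace ℝ (Fin n)) (hx : t ≤ |f x|) :
      t ^ (2 * k) ≤ 2 ^ (2 * k - 1) * (‖x‖ ^ (2 * k) + M ^ k) := by
    have h1 : √M ^ (2 * k) = M ^ k := by rw [pow_mul, Real.sq_sqrt hM]
    rw [← h1]
    exact (pow_le_pow_left₀ ht.le (hx.trans (hfb x)) _).trans
      (add_pow_le (norm_nonneg _) (Real.sqrt_nonneg _) _)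
  have hms : MeasurableSet {x | t ≤ |f x|} :=
    measurableSet_le measurable_const (measurable_abs.comp hf.continuous.measurable)
  have h2 : ENNReal.ofReal (t ^ (2 * k)) * μ {x | t ≤ |f x|} ≤
      ENNReal.ofReal (2 ^ (2 * k) * M ^ k) := by
    rw [← lintegral_indicator_const hms]
    calc ∫⁻ x, Set.indicator {x | t ≤ |f x|} (fun _ => ENNReal.ofReal (t ^ (2 * k))) x ∂μ
        ≤ ∫⁻ x, ENNReal.ofReal (2 ^ (2 * k - 1)) *
            (ENNReal.ofReal (‖x‖ ^ (2 * k)) + ENNReal.ofReal (M ^ k)) ∂μ := by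
          refine lintegral_mono (Set.indicator_le fun x hx => ?_)
          rw [← ENNReal.ofReal_add (by positivity) (by positivity),
            ← ENNReal.ofReal_mul (by positivity)]
          exact ENNReal.ofReal_le_ofReal (hpow x hx)
      _ ≤ ENNReal.ofReal (2 ^ (2 * k - 1)) *
            (ENNReal.ofReal (M ^ k) + ENNReal.ofReal (M ^ k)) := by
          rw [lintegral_const_mul' _ _ ENNReal.ofReal_ne_top,
            lintegral_add_right _ measurable_const, lintegral_const, measure_univ, mul_one]
          gcongr
          exact lintegral_norm_pow_rescaledCauchy_le hn hk
      _ = _ := by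
          rw [← ENNReal.ofReal_add (by positivity) (by positivity),
            ← ENNReal.ofReal_mul (by positivity)]
          congr 1
          rw [show 2 * k = (2 * k - 1) + 1 by omega, pow_succ]
          simp only [Nat.add_sub_cancel]
          ring
  have ht2 : 0 < t ^ (2 * k) := by positivity
  have h3 := (ENNReal.le_div_iff_mul_le (Or.inl (ENNReal.ofReal_pos.2 ht2).ne')
    (Or.inl ENNReal.ofReal_ne_top)).2 ((mul_comm _ _).trans_le h2)
  refine h3.trans (le_of_eq ?_)
  rw [← ENNReal.ofReal_div_of_pos ht2]
  congr 1
  rw [div_pow, pow_mul t, pow_mul (2 : ℝ), ← mul_pow, hMdef]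
  congr 2
  ring

/-! ### The three regimes -/

lemma one_le_cauchyIndex {n : ℕ} {β : ℝ} (hβ : (n : ℝ) + 1 ≤ β) : 1 ≤ cauchyIndex n β := by
  rw [cauchyIndex, Nat.one_le_floor_iff]
  linarith [Nat.cast_nonneg (α := ℝ) n]

lemma cauchyIndex_le {n : ℕ} {β : ℝ} (hβ : (n : ℝ) + 1 ≤ β) :
    cauchyIndex n β ≤ β - 3 / 4 * n :=
  Nat.floor_le (by linarith [Nat.cast_nonneg (α := ℝ) n])

lemma sub_half_lt_two_mul_cauchyIndex_add_one {n : ℕ} {β : ℝ} (hβ : (n : ℝ) + 1 ≤ β) :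
    β - n / 2 < 2 * cauchyIndex n β + 1 := by
  have := Nat.lt_floor_add_one (β - 3 / 4 * (n : ℝ))
  rw [cauchyIndex]
  linarith

lemma rescaledCauchy_zero_dim_tail {β : ℝ} (hβ : 0 < β) {f : EuclideanSpace ℝ (Fin 0) → ℝ}
    (hmean : ∫ x, f x ∂(rescaledCauchy 0 β) = 0) {t : ℝ} (ht : 0 < t) :
    rescaledCauchy 0 β {x | t ≤ |f x|} = 0 := by
  have hprob := isProbabilityMeasure_rescaledCauchy (n := 0) (β := β) (by simpa using hβ)
  have hconst : f = fun _ => f 0 := funext fun x => congrArg f (Subsingleton.elim x 0)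
  rw [hconst, integral_const, probReal_univ, one_smul] at hmean
  have : {x | t ≤ |f x|} = ∅ := by
    rw [hconst, hmean]
    exact Set.eq_empty_of_forall_notMem fun x hx => by simpa using ht.trans_le hx
  rw [this, measure_empty]

/-- In the first half of the exponential regime the sub-Gaussian bound at its largest admissible
parameter `q = cauchyIndex n β` suffices; in the second half the polynomial tail takes over, being
at most `exp (-cauchyIndex n β)` when `2 ≤ cauchyIndex n β`. -/
lemma rescaledCauchy_exponential_range {n : ℕ} (hn : 1 ≤ n) {β : ℝ} (hβ : (n : ℝ) + 1 ≤ β)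
    {f : EuclideanSpace ℝ (Fin n) → ℝ} (hf : LipschitzWith 1 f)
    (hmean : ∫ x, f x ∂(rescaledCauchy n β) = 0) {t : ℝ} (ht0 : tailStart n β ≤ t)
    (ht1 : t ≤ tailEnd n β) :
    rescaledCauchy n β {x | t ≤ |f x|} ≤
      ENNReal.ofReal (2 * Real.exp (-(t / (7 * Real.exp 1)))) := by
  have he := Real.exp_one_gt_d9
  have hl := Real.log_two_gt_d9
  have hn' : (1 : ℝ) ≤ n := by exact_mod_cast hn
  have hprob := isProbabilityMeasure_rescaledCauchy (n := n) (β := β) (by linarith)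
  have hk1 := one_le_cauchyIndex hβ
  have hka := sub_half_lt_two_mul_cauchyIndex_add_one hβ
  rw [tailStart] at ht0
  rw [tailEnd] at ht1
  have hkle := cauchyIndex_le hβ
  set k := cauchyIndex n β
  have hk1' : (1 : ℝ) ≤ k := by exact_mod_cast hk1
  rcases le_or_gt t (7 * Real.exp 1 * k / 2) with h | h
  · refine (rescaledCauchy_gaussian_range hn hβ hf hmean hkle ht0).trans ?_
    refine ENNReal.ofReal_le_ofReal ?_
    have : t / (7 * Real.exp 1) ≤ k / 2 := by
      rw [div_le_iff₀ (by positivity)]; linarith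
    gcongr
  have ht : 0 < t := lt_trans (by positivity) h
  have hend : Real.exp (-k) ≤ Real.exp (-(t / (7 * Real.exp 1))) := by
    refine Real.exp_le_exp.2 (neg_le_neg ?_)
    rw [div_le_iff₀ (by positivity)]; linarith
  have hpoly := rescaledCauchy_polynomial_tail hn hβ hf hmean hk1 hkle ht
  rcases hk1.eq_or_lt with hk | hk
  -- with second moments only, the bound is trivial up to `7 e log 2`, and Chebyshev suffices beyond
  · rcases le_or_gt t (7 * Real.exp 1 * Real.log 2) with h' | h'
    · refine prob_le_one.trans ?_
      rw [← ENNReal.ofReal_one]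
      refine ENNReal.ofReal_le_ofReal ?_
      have : Real.exp (-Real.log 2) ≤ Real.exp (-(t / (7 * Real.exp 1))) := by
        refine Real.exp_le_exp.2 (neg_le_neg ?_)
        rw [div_le_iff₀ (by positivity)]; linarith
      rw [Real.exp_neg, Real.exp_log zero_lt_two] at this
      linarith
    · refine hpoly.trans (ENNReal.ofReal_le_ofReal ?_)
      rw [← hk, pow_one]
      rw [← hk, Nat.cast_one] at hka hend
      have h13 : 13 ≤ t := by nlinarith
      have h2 : 24 * (β - n / 2) / t ^ 2 ≤ 1 / 2 := by
        rw [div_le_iff₀ (by positivity)]; nlinarith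
      have h3 : (1 : ℝ) / 4 ≤ Real.exp (-1) := by
        rw [Real.exp_neg, ← one_div]
        exact one_div_le_one_div_of_le (Real.exp_pos _) (by linarith [Real.exp_one_lt_d9])
      linarith
  · refine hpoly.trans (ENNReal.ofReal_le_ofReal ?_)
    have hk2 : (2 : ℝ) ≤ k := by exact_mod_cast hk
    have h1 : 24 * (β - n / 2) / t ^ 2 ≤ Real.exp (-1) := by
      rw [Real.exp_neg, div_le_iff₀ (by positivity), ← div_eq_inv_mul,
        le_div_iff₀ (Real.exp_pos _)]
      have h2 : (7 * Real.exp 1 * k / 2) ^ 2 ≤ t ^ 2 := by gcongr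
      -- `β - n / 2 < 2 k + 1 ≤ 5 k / 2`
      have h3 : 24 * (β - n / 2) ≤ 60 * k := by linarith
      have h4 : 60 * k * Real.exp 1 ≤ (7 * Real.exp 1 * k / 2) ^ 2 := by
        have h5 : 60 ≤ 49 / 4 * Real.exp 1 * k := by nlinarith
        calc 60 * k * Real.exp 1 ≤ (49 / 4 * Real.exp 1 * k) * k * Real.exp 1 := by gcongr
          _ = _ := by ring
      calc 24 * (β - n / 2) * Real.exp 1 ≤ 60 * k * Real.exp 1 := by gcongr
        _ ≤ _ := h4.trans h2
    have h6 : 0 ≤ 24 * (β - n / 2) / t ^ 2 := by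
      have : 0 ≤ β - n / 2 := by linarith
      positivity
    calc (24 * (β - n / 2) / t ^ 2) ^ k ≤ Real.exp (-1) ^ k := by gcongr
      _ = Real.exp (-k) := by rw [← Real.exp_nat_mul]; ring_nf
      _ ≤ _ := by linarith [Real.exp_pos (-(t / (7 * Real.exp 1)))]

theorem corollary4p4 (n : ℕ) (β : ℝ) (hβ : (n : ℝ) + 1 ≤ β)
    (f : EuclideanSpace ℝ (Fin n) → ℝ) (hf : LipschitzWith 1 f)
    (hmean : ∫ x, f x ∂(rescaledCauchy n β) = 0) (t : ℝ) :
    (0 ≤ t → t < tailStart n β →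
      rescaledCauchy n β {x | t ≤ |f x|} ≤
        ENNReal.ofReal (2 * Real.exp (-(t ^ 2 / (32 * Real.exp 1))))) ∧
    (tailStart n β ≤ t → t ≤ tailEnd n β →
      rescaledCauchy n β {x | t ≤ |f x|} ≤
        ENNReal.ofReal (2 * Real.exp (-(t / (7 * Real.exp 1))))) ∧
    (tailEnd n β ≤ t →
      rescaledCauchy n β {x | t ≤ |f x|} ≤
        ENNReal.ofReal (2 * (7 * tailExponent n β / t) ^ tailExponent n β)) := by
  have hn0 : (0 : ℝ) ≤ n := Nat.cast_nonneg n
  have hprob := isProbabilityMeasure_rescaledCauchy (n := n) (β := β) (by linarith)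
  have he := Real.exp_pos 1
  have hk1 := one_le_cauchyIndex hβ
  have hk1' : (1 : ℝ) ≤ cauchyIndex n β := by exact_mod_cast hk1
  have hstart : 0 < tailStart n β := by rw [tailStart]; positivity
  have hend : 0 < tailEnd n β := by rw [tailEnd]; positivity
  rcases Nat.eq_zero_or_pos n with rfl | hn
  · have hz (ht : 0 < t) := rescaledCauchy_zero_dim_tail (by simp at hβ; linarith) hmean ht
    refine ⟨fun ht _ => ?_, fun h _ => ?_, fun h => ?_⟩
    · rcases ht.eq_or_lt with rfl | ht
      · refine prob_le_one.trans ?_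
        rw [← ENNReal.ofReal_one]
        exact ENNReal.ofReal_le_ofReal (by norm_num)
      · rw [hz ht]; exact zero_le
    · rw [hz (hstart.trans_le h)]; exact zero_le
    · rw [hz (hend.trans_le h)]; exact zero_le
  refine ⟨fun ht h => ?_, rescaledCauchy_exponential_range hn hβ hf hmean, fun h => ?_⟩
  · have hq : t ^ 2 / (16 * Real.exp 1) ≤ β - 3 / 4 * n := by
      refine le_trans ?_ (cauchyIndex_le hβ)
      rw [div_le_iff₀ (by positivity)]
      have h1 : t ^ 2 ≤ tailStart n β ^ 2 := by gcongr
      rw [tailStart, mul_pow, Real.sq_sqrt (by positivity)] at h1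
      linarith
    have hts : 4 * √(Real.exp 1 * (t ^ 2 / (16 * Real.exp 1))) ≤ t := by
      rw [show Real.exp 1 * (t ^ 2 / (16 * Real.exp 1)) = (t / 4) ^ 2 by field_simp; norm_num,
        Real.sqrt_sq (by positivity)]
      linarith
    refine (rescaledCauchy_gaussian_range hn hβ hf hmean hq hts).trans (le_of_eq ?_)
    congr 4
    field_simp
    ring
  · have ht : 0 < t := hend.trans_le h
    refine (rescaledCauchy_polynomial_tail hn hβ hf hmean hk1 (cauchyIndex_le hβ) ht).trans
      (ENNReal.ofReal_le_ofReal ?_)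
    have hka := sub_half_lt_two_mul_cauchyIndex_add_one hβ
    rw [tailExponent, pow_mul, div_pow _ t]
    set k := cauchyIndex n β
    have h1 : 24 * (β - n / 2) ≤ (7 * ((2 * k : ℕ) : ℝ)) ^ 2 := by
      push_cast
      nlinarith
    have h2 : 0 ≤ 24 * (β - n / 2) := by linarith
    calc (24 * (β - n / 2) / t ^ 2) ^ k ≤ ((7 * ((2 * k : ℕ) : ℝ)) ^ 2 / t ^ 2) ^ k := by gcongr
      _ ≤ 2 * ((7 * ((2 * k : ℕ) : ℝ)) ^ 2 / t ^ 2) ^ k := by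
        linarith [show 0 ≤ ((7 * ((2 * k : ℕ) : ℝ)) ^ 2 / t ^ 2) ^ k by positivity]
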